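/- Let $K$ be an algebraically closed field of characteristic zero, let $n\ge 0$, and let $(r_1,\dots,r_s)$ be a sequence of positive integers with $r_1+\dots+r_s=n$. Divide the rows and columns of $n\times n$ matrices into consecutive blocks of sizes $r_1,\dots,r_s$; the block $X_{k,l}$ consists of the positions whose row is in the $k$-th and whose column is in the $l$-th group. Let $M$ be the set of positions $(i,j)$ that lie in a block $X_{k,l}$ with $k<l$, let $\mathfrak m=\bigoplus_{(i,j)\in M}KE_{i,j}$ (the nilradical of the standard parabolic subalgebra of $\mathfrak{gl}(n,K)$ with these blocks), and let $U=\{g\in \mathrm{GL}(n,K): g-I\in\mathfrak m\}$ (the unipotent radical of the corresponding parabolic subgroup), acting on $\mathfrak m$ by $\mathrm{Ad}_g x=gxg^{-1}$. Identify a pair $(i,j)$, $i<j$, with the positive root $\varepsilon_i-\varepsilon_j$, and write $\gamma'>\gamma$ if $\gamma'-\gamma$ is a positive root. Let $S\subset M$ be the base, that is, the unique subset of $M$ such that no two elements $\xi,\eta$ of $S$ satisfy $\xi>\eta$, and for each $\gamma\in M\setminus S$ there is $\xi\in S$ with $\gamma>\xi$. Let the broad base $T$ be the set of all positive roots $\xi$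 such that $\xi\in S$, or there is $\gamma\in S$ with $\xi>\gamma$ for which the positions $\xi$ and $\gamma$ lie in the same block $X_{k,l}$. Put $\mathcal Z=\operatorname{span}_K\{E_\xi:\xi\in T\}$. Then there exists a nonempty Zariski-open subset $V\subset\mathfrak m$ such that for every $x\in V$ the $U$-orbit of $x$ intersects $\mathcal Z$ in exactly one point. -/

import Mathlib

namespace UnitriangularInvariants

/-! The sizes `(r_1, …, r_s)` of the diagonal blocks are given by a composition `c` of `n`;
`c.index i : Fin c.length` is the number of the block that contains the index `i : Fin n`.
The pair `(i, j)` stands for the root `ε_i - ε_j`. -/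

/-- The positive roots of `gl(n)`, as the pairs `(i, j)` with `i < j`. -/
def posRoots (n : ℕ) : Set (Fin n × Fin n) := {γ | γ.1 < γ.2}

/-- The vector `ε_i - ε_j` of the pair `(i, j)`. -/
def rootVec {n : ℕ} (γ : Fin n × Fin n) : Fin n → ℤ := Pi.single γ.1 1 - Pi.single γ.2 1

/-- The relation `γ' > γ`: the difference `γ' - γ` is a positive root. -/
def RootGT {n : ℕ} (γ' γ : Fin n × Fin n) : Prop :=
  ∃ δ ∈ posRoots n, rootVec γ' - rootVec γ = rootVec δ

/-- The set `M` of the roots of the nilradical: the positions strictly above the diagonal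
blocks. -/
def nilRoots {n : ℕ} (c : Composition n) : Set (Fin n × Fin n) :=
  {γ | c.index γ.1 < c.index γ.2}

/-- `ξ` is a minimal element of `A`: it lies in `A` and no element of `A` is smaller. -/
def IsMinimalIn {n : ℕ} (A : Set (Fin n × Fin n)) (ξ : Fin n × Fin n) : Prop :=
  ξ ∈ A ∧ ¬ ∃ η ∈ A, RootGT ξ η

/-- A base: a set of pairwise incomparable elements of `M` such that each other element of `M`
is greater than some element of the set. -/
def IsBase {n : ℕ} (c : Composition n) (S : Set (Fin n × Fin n)) : Prop :=
  S ⊆ nilRoots c ∧ (∀ ξ ∈ S, ∀ η ∈ S, ¬ RootGT ξ η) ∧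
    ∀ γ ∈ nilRoots c \ S, ∃ ξ ∈ S, RootGT γ ξ

/-- The sets `M_0 = M ⊇ M_1 ⊇ …` of the algorithm that constructs the base: at each step the
minimal elements, and all elements greater than one of them, are removed. -/
def residual {n : ℕ} (c : Composition n) : ℕ → Set (Fin n × Fin n)
  | 0 => nilRoots c
  | k + 1 => {γ | γ ∈ residual c k ∧ ¬ IsMinimalIn (residual c k) γ ∧
      ¬ ∃ ξ, IsMinimalIn (residual c k) ξ ∧ RootGT γ ξ}

/-- The base `S`: the union of the sets of minimal elements that the algorithm removes. By
`isBase_base` and `IsBase.eq_base` it is the one and only base. -/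
def base {n : ℕ} (c : Composition n) : Set (Fin n × Fin n) :=
  {ξ | ∃ k, IsMinimalIn (residual c k) ξ}

/-- Two positions are located in the same block `X_{k,l}`. -/
def SameBlock {n : ℕ} (c : Composition n) (ξ γ : Fin n × Fin n) : Prop :=
  c.index ξ.1 = c.index γ.1 ∧ c.index ξ.2 = c.index γ.2

/-- The broad base `T`. -/
def broadBase {n : ℕ} (c : Composition n) : Set (Fin n × Fin n) :=
  {ξ | ξ ∈ posRoots n ∧
    (ξ ∈ base c ∨ ∃ γ ∈ base c, RootGT ξ γ ∧ SameBlock c ξ γ)}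

/-- The nilradical `m` of the standard parabolic subalgebra: the matrices with entries zero
outside of the positions in `M`. -/
def nilradical (K : Type*) [Field K] {n : ℕ} (c : Composition n) :
    Submodule K (Matrix (Fin n) (Fin n) K) where
  carrier := {x | ∀ i j, (i, j) ∉ nilRoots c → x i j = 0}
  add_mem' := by
    intro x y hx hy i j hij
    simp [hx i j hij, hy i j hij]
  zero_mem' := by
    intro i j _
    rfl
  smul_mem' := by
    intro a x hx i j hij
    simp [hx i j hij]

/-- The subspace `Z`, spanned by the matrix units `E_ξ` for `ξ ∈ T`. -/
def sectionSpace (K : Type*) [Field K] {n : ℕ} (c : Composition n) :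
    Submodule K (Matrix (Fin n) (Fin n) K) :=
  Submodule.span K ((fun ξ : Fin n × Fin n => Matrix.single ξ.1 ξ.2 (1 : K)) '' broadBase c)

theorem mul_mem_nilradical {K : Type*} [Field K] {n : ℕ} {c : Composition n}
    {p x : Matrix (Fin n) (Fin n) K} (hp : p.BlockTriangular c.index)
    (hx : x ∈ nilradical K c) : p * x ∈ nilradical K c := by
  intro i j hij
  rw [Matrix.mul_apply]
  refine Finset.sum_eq_zero fun k _ => ?_
  by_cases h : c.index k < c.index i
  · rw [hp h, zero_mul]
  · rw [hx k j fun hk => hij (lt_of_le_of_lt (not_lt.1 h) hk), mul_zero]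

theorem blockTriangular_of_sub_one_mem {K : Type*} [Field K] {n : ℕ} {c : Composition n}
    {g : Matrix (Fin n) (Fin n) K} (hg : g - 1 ∈ nilradical K c) :
    g.BlockTriangular c.index := by
  have h1 : (g - 1).BlockTriangular c.index := fun i j h => hg i j (lt_asymm h)
  simpa using h1.add Matrix.blockTriangular_one

/-- The unipotent radical `U` of the standard parabolic subgroup `P` of `GL(n, K)`: the block
upper triangular matrices with identity matrices as diagonal blocks, `U = 1 + m`. -/
def unipotentRadical (K : Type*) [Field K] {n : ℕ} (c : Composition n) :
    Subgroup (GL (Fin n) K) where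
  carrier := {g | (g : Matrix (Fin n) (Fin n) K) - 1 ∈ nilradical K c}
  mul_mem' := by
    intro g h hg hh
    have e : ((g * h : GL (Fin n) K) : Matrix (Fin n) (Fin n) K) - 1 =
        (g : Matrix (Fin n) (Fin n) K) * ((h : Matrix (Fin n) (Fin n) K) - 1) +
          ((g : Matrix (Fin n) (Fin n) K) - 1) := by
      rw [Units.val_mul]; noncomm_ring
    change _ ∈ nilradical K c
    rw [e]
    exact add_mem (mul_mem_nilradical (blockTriangular_of_sub_one_mem hg) hh) hg
  one_mem' := by
    change _ ∈ nilradical K c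
    simp
  inv_mem' := by
    intro g hg
    have hB : ((g⁻¹ : GL (Fin n) K) : Matrix (Fin n) (Fin n) K).BlockTriangular c.index := by
      rw [Matrix.coe_units_inv]
      have : Invertible (g : Matrix (Fin n) (Fin n) K) := g.invertible
      exact Matrix.blockTriangular_inv_of_blockTriangular (blockTriangular_of_sub_one_mem hg)
    have e : ((g⁻¹ : GL (Fin n) K) : Matrix (Fin n) (Fin n) K) - 1 =
        -(((g⁻¹ : GL (Fin n) K) : Matrix (Fin n) (Fin n) K) *
          ((g : Matrix (Fin n) (Fin n) K) - 1)) := by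
      rw [mul_sub, mul_one, Units.inv_mul]; abel
    change _ ∈ nilradical K c
    rw [e]
    exact neg_mem (mul_mem_nilradical hB hg)

/-- The orbit of `x` under the adjoint action `Ad_g x = g x g⁻¹` of `U`. -/
def unipotentOrbit {K : Type*} [Field K] {n : ℕ} (c : Composition n)
    (x : Matrix (Fin n) (Fin n) K) : Set (Matrix (Fin n) (Fin n) K) :=
  {y | ∃ g ∈ unipotentRadical K c,
    y = (g : Matrix (Fin n) (Fin n) K) * x * ((g⁻¹ : GL (Fin n) K) : Matrix (Fin n) (Fin n) K)}

/-- The coordinates `x_γ`, `γ ∈ M`, of an element of `m`. -/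
def coords {K : Type*} [Field K] {n : ℕ} {c : Composition n} (x : nilradical K c) :
    nilRoots c → K :=
  fun γ => (x : Matrix (Fin n) (Fin n) K) γ.1.1 γ.1.2

/-- A subset of `m` is Zariski-open if it is the complement of the zero set of an ideal of the
coordinate algebra `K[m] = K[x_γ : γ ∈ M]`. -/
def IsZariskiOpen {K : Type*} [Field K] {n : ℕ} {c : Composition n}
    (V : Set (nilradical K c)) : Prop :=
  ∃ I : Ideal (MvPolynomial (nilRoots c) K),
    V = {x | coords x ∉ MvPolynomial.zeroLocus K I}

/-! The base is well defined. -/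

/-- `γ' > γ` means: the same row and further to the right, or the same column and higher. -/
theorem rootGT_iff {n : ℕ} {γ' γ : Fin n × Fin n} (h' : γ' ∈ posRoots n) (h : γ ∈ posRoots n) :
    RootGT γ' γ ↔ (γ'.1 = γ.1 ∧ γ.2 < γ'.2) ∨ (γ'.2 = γ.2 ∧ γ'.1 < γ.1) := by
  obtain ⟨a, b⟩ := γ'
  obtain ⟨i, j⟩ := γ
  have hab : a < b := h'
  have hij : i < j := h
  constructor
  · rintro ⟨⟨u, v⟩, huv, e⟩
    have huv : u < v := huv
    have ea := congrFun e a
    have eb := congrFun e b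
    have ei := congrFun e i
    have ej := congrFun e j
    have eu := congrFun e u
    have ev := congrFun e v
    simp only [rootVec, Pi.sub_apply, Pi.single_apply] at ea eb ei ej eu ev
    grind
  · rintro (⟨h1, h2⟩ | ⟨h1, h2⟩)
    · simp only at h1 h2
      subst h1
      exact ⟨(j, b), h2, by simp [rootVec]⟩
    · simp only at h1 h2
      subst h1
      exact ⟨(a, i), h2, by simp [rootVec]⟩

theorem nilRoots_subset {n : ℕ} (c : Composition n) : nilRoots c ⊆ posRoots n := by
  rintro ⟨i, j⟩ h
  by_contra hij
  have hle : j ≤ i := not_lt.1 hij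
  have hlt : c.index i < c.index j := h
  have h1 : c.sizeUpTo (c.index i).succ ≤ c.sizeUpTo (c.index j) :=
    c.monotone_sizeUpTo (by simpa using hlt)
  have h2 := c.lt_sizeUpTo_index_succ i
  have h3 := c.sizeUpTo_index_le j
  have h4 : (j : ℕ) ≤ i := hle
  omega

/-- The height `j - i` of the root `(i, j)`. -/
def height {n : ℕ} (γ : Fin n × Fin n) : ℕ := (γ.2 : ℕ) - γ.1

theorem height_lt {n : ℕ} {γ' γ : Fin n × Fin n} (h' : γ' ∈ posRoots n) (h : γ ∈ posRoots n)
    (hgt : RootGT γ' γ) : height γ < height γ' := by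
  have h1 : (γ'.1 : ℕ) < γ'.2 := h'
  have h2 : (γ.1 : ℕ) < γ.2 := h
  unfold height
  rcases (rootGT_iff h' h).1 hgt with ⟨e, l⟩ | ⟨e, l⟩
  · have l' : (γ.2 : ℕ) < γ'.2 := l
    rw [e] at h1 ⊢; omega
  · have l' : (γ'.1 : ℕ) < γ.1 := l
    rw [e] at h1 ⊢; omega

theorem residual_antitone {n : ℕ} (c : Composition n) : Antitone (residual c) :=
  antitone_nat_of_succ_le fun _ _ h => h.1

theorem residual_subset {n : ℕ} (c : Composition n) (k : ℕ) : residual c k ⊆ nilRoots c :=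
  residual_antitone c (Nat.zero_le k)

theorem lt_height_of_mem_residual {n : ℕ} (c : Composition n) (k : ℕ) :
    ∀ γ ∈ residual c k, k < height γ := by
  induction k with
  | zero =>
    intro γ h
    have : (γ.1 : ℕ) < γ.2 := nilRoots_subset c h
    unfold height
    omega
  | succ k ih =>
    intro γ h
    have hmin : ∃ η ∈ residual c k, RootGT γ η := by
      by_contra hno
      exact h.2.1 ⟨h.1, hno⟩
    obtain ⟨η, hη, hgt⟩ := hmin
    have h1 := height_lt (nilRoots_subset c (residual_subset c k h.1))
      (nilRoots_subset c (residual_subset c k hη)) hgt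
    have h2 := ih η hη
    omega

theorem isBase_base {n : ℕ} (c : Composition n) : IsBase c (base c) := by
  refine ⟨?_, ?_, ?_⟩
  · rintro ξ ⟨k, hk⟩
    exact residual_subset c k hk.1
  · rintro ξ ⟨k, hk⟩ η ⟨l, hl⟩ hgt
    rcases le_or_gt k l with hkl | hkl
    · exact hk.2 ⟨η, residual_antitone c hkl hl.1, hgt⟩
    · exact (residual_antitone c (Nat.succ_le_of_lt hkl) hk.1).2.2 ⟨η, hl, hgt⟩
  · rintro γ ⟨hγ, hγS⟩
    by_contra hno
    have hall : ∀ k, γ ∈ residual c k := by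
      intro k
      induction k with
      | zero => exact hγ
      | succ k ih =>
        exact ⟨ih, fun hm => hγS ⟨k, hm⟩, fun ⟨ξ, hξ, hgt⟩ => hno ⟨ξ, ⟨k, hξ⟩, hgt⟩⟩
    exact lt_irrefl _ (lt_height_of_mem_residual c _ γ (hall (height γ)))

theorem IsBase.eq_base {n : ℕ} {c : Composition n} {S : Set (Fin n × Fin n)}
    (hS : IsBase c S) : S = base c := by
  have key : ∀ m, ∀ γ ∈ nilRoots c, height γ = m → (γ ∈ S ↔ γ ∈ base c) := by
    intro m
    induction m using Nat.strong_induction_on with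
    | _ m ih =>
      have aux : ∀ A B : Set (Fin n × Fin n), IsBase c A → IsBase c B →
          (∀ k < m, ∀ γ ∈ nilRoots c, height γ = k → (γ ∈ A ↔ γ ∈ B)) →
          ∀ γ ∈ nilRoots c, height γ = m → γ ∈ A → γ ∈ B := by
        intro A B hA hB hAB γ hγ hm hγA
        by_contra hγB
        obtain ⟨ξ, hξ, hgt⟩ := hB.2.2 γ ⟨hγ, hγB⟩
        have hlt := height_lt (nilRoots_subset c hγ) (nilRoots_subset c (hB.1 hξ)) hgt
        exact hA.2.1 γ hγA ξ ((hAB _ (hm ▸ hlt) ξ (hB.1 hξ) rfl).2 hξ) hgt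
      intro γ hγ hm
      exact ⟨aux S (base c) hS (isBase_base c) ih γ hγ hm,
        aux (base c) S (isBase_base c) hS (fun k hk η h e => (ih k hk η h e).symm) γ hγ hm⟩
  ext γ
  exact ⟨fun h => (key _ γ (hS.1 h) rfl).1 h,
    fun h => (key _ γ ((isBase_base c).1 h) rfl).2 h⟩

end UnitriangularInvariants

/-! Two open conditions on `x` carry the proof. `HasBasePivots`: column elimination from left to
right, pivoting on the lowest nonzero entry, has its pivots exactly at the base positions;
nonvanishing of the `baseMinor`s at base positions forces this. `IsRichardson`: the commutators of
`x` with block triangular matrices fill the nilradical; nonvanishing of a suitable `commutatorDet`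
forces this. The polynomials involved take the value 1 at `baseMatrix` and at `richardson`
respectively, so their product is nonzero and defines the open set (`exists_isZariskiOpen_generic`).
Both conditions are invariant under `U`.

Write `V_k` for the span of the first `k` blocks of basis vectors (`blockSpan`).

Existence (`exists_conj_mem_section`) clears the columns off the broad base one block at a time.
Modulo `x V_k`, a column of block `k` can be made zero in the rows whose base position lies in an
earlier column block. At any other position of the nilradical off the broad base, the same column
has a base position in a later row block (`exists_base_below`). Columns with such pivots are
independent enough (`linearIndependent_columns`) for some `N` in the nilradical with `N x V_k = 0`
to correct these entries. Writing `N` as a commutator `[W, x]` turns this linear correction into a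
conjugation that fixes the columns already treated.

Uniqueness (`section_eq_of_conj`) needs only the pivots. Two conjugate section elements are compared
by column blocks from the left, and within a block by row blocks from the bottom. A first
difference, from its row block downwards, would be a vector `z u` with `u` in `V_k`. Its leading row
would then hold a base position in an earlier column block than one of its broad base positions,
which `index_le_of_mem_broadBase_of_mem_base` excludes. -/

namespace UnitriangularInvariants

open scoped Matrix

/-! ### Combinatorics of the base and the broad base. -/

section Combinatorics

variable {n : ℕ} {c : Composition n}

theorem lt_of_index_lt {i j : Fin n} (h : c.index i < c.index j) : i < j :=
  nilRoots_subset c (show (i, j) ∈ nilRoots c from h)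

theorem index_mono {i j : Fin n} (h : i ≤ j) : c.index i ≤ c.index j := by
  by_contra hlt
  exact absurd (lt_of_index_lt (not_le.1 hlt)) (not_lt.2 h)

theorem index_lt_of_mem_base {i j : Fin n} (h : (i, j) ∈ base c) : c.index i < c.index j :=
  (isBase_base c).1 h

theorem lt_of_mem_base {i j : Fin n} (h : (i, j) ∈ base c) : i < j :=
  lt_of_index_lt (index_lt_of_mem_base h)

theorem base_row_unique {i j j' : Fin n} (h : (i, j) ∈ base c) (h' : (i, j') ∈ base c) :
    j = j' := by
  have key : ∀ {a b : Fin n}, (i, a) ∈ base c → (i, b) ∈ base c → ¬ a < b := fun ha hb hab =>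
    (isBase_base c).2.1 _ hb _ ha
      ((rootGT_iff (lt_of_mem_base hb) (lt_of_mem_base ha)).2 (Or.inl ⟨rfl, hab⟩))
  exact le_antisymm (not_lt.1 (key h' h)) (not_lt.1 (key h h'))

theorem base_col_unique {i i' j : Fin n} (h : (i, j) ∈ base c) (h' : (i', j) ∈ base c) :
    i = i' := by
  have key : ∀ {a b : Fin n}, (a, j) ∈ base c → (b, j) ∈ base c → ¬ a < b := fun ha hb hab =>
    (isBase_base c).2.1 _ ha _ hb
      ((rootGT_iff (lt_of_mem_base ha) (lt_of_mem_base hb)).2 (Or.inr ⟨rfl, hab⟩))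
  exact le_antisymm (not_lt.1 (key h' h)) (not_lt.1 (key h h'))

theorem base_cover {i j : Fin n} (h : c.index i < c.index j) :
    (i, j) ∈ base c ∨ (∃ j' < j, (i, j') ∈ base c) ∨ ∃ i' > i, (i', j) ∈ base c := by
  by_cases hS : (i, j) ∈ base c
  · exact Or.inl hS
  · obtain ⟨⟨a, b⟩, hξ, hgt⟩ := (isBase_base c).2.2 (i, j) ⟨h, hS⟩
    rcases (rootGT_iff (lt_of_index_lt h) (lt_of_mem_base hξ)).1 hgt with ⟨e, l⟩ | ⟨e, l⟩
    · simp only at e l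
      subst e
      exact Or.inr (Or.inl ⟨b, l, hξ⟩)
    · simp only at e l
      subst e
      exact Or.inr (Or.inr ⟨a, l, hξ⟩)

theorem mem_broadBase_iff {i j : Fin n} : (i, j) ∈ broadBase c ↔ (i, j) ∈ base c ∨
    (∃ j' < j, (i, j') ∈ base c ∧ c.index j' = c.index j) ∨
    ∃ i' > i, (i', j) ∈ base c ∧ c.index i' = c.index i := by
  constructor
  · rintro ⟨hp, hS | ⟨⟨a, b⟩, hξ, hgt, h1, h2⟩⟩
    · exact Or.inl hS
    · rcases (rootGT_iff hp (lt_of_mem_base hξ)).1 hgt with ⟨e, l⟩ | ⟨e, l⟩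
      · simp only at e l h1 h2
        subst e
        exact Or.inr (Or.inl ⟨b, l, hξ, h2.symm⟩)
      · simp only at e l h1 h2
        subst e
        exact Or.inr (Or.inr ⟨a, l, hξ, h1.symm⟩)
  · rintro (h | ⟨j', hj, h, e⟩ | ⟨i', hi, h, e⟩)
    · exact ⟨lt_of_mem_base h, Or.inl h⟩
    · have hp : i < j := (lt_of_mem_base h).trans hj
      exact ⟨hp, Or.inr ⟨(i, j'), h,
        (rootGT_iff hp (lt_of_mem_base h)).2 (Or.inl ⟨rfl, hj⟩), rfl, e.symm⟩⟩
    · have hp : i < j := lt_trans hi (lt_of_mem_base h)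
      exact ⟨hp, Or.inr ⟨(i', j), h,
        (rootGT_iff hp (lt_of_mem_base h)).2 (Or.inr ⟨rfl, hi⟩), e.symm, rfl⟩⟩

theorem index_lt_of_mem_broadBase {i j : Fin n} (h : (i, j) ∈ broadBase c) :
    c.index i < c.index j := by
  rcases mem_broadBase_iff.1 h with h | ⟨j', -, h, e⟩ | ⟨i', -, h, e⟩
  · exact index_lt_of_mem_base h
  · exact e ▸ index_lt_of_mem_base h
  · exact e ▸ index_lt_of_mem_base h

/-- The base does not contain the upper left and the lower right corner of a rectangle whose
lower left corner lies in the nilradical. -/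
theorem not_base_cross {i i' j j' : Fin n} (h : (i, j') ∈ base c) (h' : (i', j) ∈ base c)
    (hi : i < i') (hj : j' < j) : ¬ c.index i' < c.index j' := by
  intro hlt
  rcases base_cover hlt with h1 | ⟨j₁, hj₁, h1⟩ | ⟨i₁, hi₁, h1⟩
  · exact hi.ne (base_col_unique h h1)
  · exact (hj₁.trans hj).ne (base_row_unique h1 h')
  · exact (hi.trans hi₁).ne (base_col_unique h h1)

/-- A broad base position shares its block with a base position in its row or its column. In the row
case, a row has only one base position; in the column case, a violation would be a crossing excluded
by `not_base_cross`. -/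
theorem index_le_of_mem_broadBase_of_mem_base {i j j' : Fin n} (hT : (i, j) ∈ broadBase c)
    (hS : (i, j') ∈ base c) : c.index j ≤ c.index j' := by
  by_contra hlt
  rw [not_le] at hlt
  rcases mem_broadBase_iff.1 hT with h | ⟨j₁, -, h, e⟩ | ⟨i', hi, h, e⟩
  · rw [base_row_unique h hS] at hlt; exact lt_irrefl _ hlt
  · rw [← e, base_row_unique h hS] at hlt; exact lt_irrefl _ hlt
  · exact not_base_cross hS h hi (lt_of_index_lt hlt) (e ▸ index_lt_of_mem_base hS)

theorem index_le_of_mem_base_of_mem_broadBase {i i' j : Fin n} (hT : (i, j) ∈ broadBase c)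
    (hS : (i', j) ∈ base c) : c.index i' ≤ c.index i := by
  by_contra hlt
  rw [not_le] at hlt
  rcases mem_broadBase_iff.1 hT with h | ⟨j₁, hj, h, e⟩ | ⟨i₁, -, h, e⟩
  · rw [base_col_unique h hS] at hlt; exact lt_irrefl _ hlt
  · exact not_base_cross h hS (lt_of_index_lt hlt) hj (e ▸ index_lt_of_mem_base hS)
  · rw [← e, base_col_unique h hS] at hlt; exact lt_irrefl _ hlt

/-- The base covers `(i, j)` from the left or from below. A cover from the left in an earlier block
is excluded by `hrow`, and a cover from within the same block would put `(i, j)` in the broad base.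
-/
theorem exists_base_below {i j : Fin n} (hij : c.index i < c.index j)
    (hrow : ∀ j', (i, j') ∈ base c → c.index j ≤ c.index j') (hT : (i, j) ∉ broadBase c) :
    ∃ i', (i', j) ∈ base c ∧ c.index i < c.index i' := by
  rw [mem_broadBase_iff] at hT
  push Not at hT
  rcases base_cover hij with h | ⟨j', hj, h⟩ | ⟨i', hi, h⟩
  · exact absurd h hT.1
  · exact absurd (le_antisymm (index_mono hj.le) (hrow j' h)) (hT.2.1 j' hj h)
  · exact ⟨i', h, lt_of_le_of_ne (index_mono (le_of_lt hi)) fun e => hT.2.2 i' hi h e.symm⟩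

end Combinatorics

theorem mem_sectionSpace_iff {K : Type*} [Field K] {n : ℕ} {c : Composition n}
    {z : Matrix (Fin n) (Fin n) K} :
    z ∈ sectionSpace K c ↔ ∀ i j, (i, j) ∉ broadBase c → z i j = 0 := by
  constructor
  · intro hz
    induction hz using Submodule.span_induction with
    | mem x hx =>
      obtain ⟨⟨a, b⟩, hξ, rfl⟩ := hx
      intro i j hij
      refine Matrix.single_apply_of_ne _ _ _ _ _ ?_
      rintro ⟨rfl, rfl⟩
      exact hij hξ
    | zero => intros; rfl
    | add x y _ _ hx hy => intro i j hij; simp [hx i j hij, hy i j hij]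
    | smul a x _ hx => intro i j hij; simp [hx i j hij]
  · intro h
    rw [Matrix.matrix_eq_sum_single z]
    refine Submodule.sum_mem _ fun i _ => Submodule.sum_mem _ fun j _ => ?_
    by_cases hij : (i, j) ∈ broadBase c
    · have : Matrix.single i j (z i j) = z i j • Matrix.single i j (1 : K) := by simp
      rw [this]
      exact Submodule.smul_mem _ _ (Submodule.subset_span ⟨(i, j), hij, rfl⟩)
    · rw [h i j hij, Matrix.single_zero]
      exact Submodule.zero_mem _

/-! ### A Richardson element and the surjectivity of its commutator map. -/

section Richardson

variable {n : ℕ} (c : Composition n)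

/-- The position of an index within its block. -/
def localPos (i : Fin n) : ℕ := c.invEmbedding i

variable {c}

theorem eq_of_index_eq_of_localPos_eq {i j : Fin n} (h : c.index i = c.index j)
    (h' : localPos c i = localPos c j) : i = j := by
  unfold localPos at h'
  rw [c.coe_invEmbedding, c.coe_invEmbedding, h] at h'
  have h1 := c.sizeUpTo_index_le i
  have h2 := c.sizeUpTo_index_le j
  rw [h] at h1
  ext
  omega

theorem exists_localPos_eq {a : Fin n} {q : ℕ} (h : q ≤ localPos c a) :
    ∃ a', c.index a' = c.index a ∧ localPos c a' = q := by
  have hq : q < c.blocksFun (c.index a) := lt_of_le_of_lt h (c.invEmbedding a).2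
  refine ⟨c.embedding (c.index a) ⟨q, hq⟩, c.index_embedding _ _, ?_⟩
  unfold localPos
  rw [c.coe_invEmbedding, c.index_embedding, c.coe_embedding]
  simp

variable (c) in
/-- `i` is the last index before `j` with the same position within its block. -/
def IsPred (i j : Fin n) : Prop :=
  localPos c i = localPos c j ∧ i < j ∧ ∀ m, localPos c m = localPos c j → m < j → m ≤ i

theorem IsPred.index_lt {i j : Fin n} (h : IsPred c i j) : c.index i < c.index j :=
  lt_of_le_of_ne (index_mono h.2.1.le) fun e => h.2.1.ne (eq_of_index_eq_of_localPos_eq e h.1)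

theorem IsPred.left_unique {i i' j : Fin n} (h : IsPred c i j) (h' : IsPred c i' j) : i = i' :=
  le_antisymm (h'.2.2 i h.1 h.2.1) (h.2.2 i' h'.1 h'.2.1)

theorem IsPred.right_unique {i j j' : Fin n} (h : IsPred c i j) (h' : IsPred c i j') :
    j = j' := by
  have key : ∀ {a b : Fin n}, IsPred c i a → IsPred c i b → ¬ a < b := fun ha hb hab =>
    absurd (hb.2.2 _ (ha.1.symm.trans hb.1) hab) (not_le.2 ha.2.1)
  exact le_antisymm (not_lt.1 (key h' h)) (not_lt.1 (key h h'))

theorem exists_isPred_left {m j : Fin n} (h : localPos c m = localPos c j) (hm : m < j) :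
    ∃ i, IsPred c i j ∧ m ≤ i := by
  classical
  obtain ⟨i, hi, hmax⟩ := Finset.exists_max_image
    (Finset.univ.filter fun i => localPos c i = localPos c j ∧ i < j) id ⟨m, by simp [h, hm]⟩
  simp only [Finset.mem_filter, Finset.mem_univ, true_and, id] at hi hmax
  exact ⟨i, ⟨hi.1, hi.2, fun a ha ha' => hmax a ⟨ha, ha'⟩⟩, hmax m ⟨h, hm⟩⟩

theorem exists_isPred_right {i m : Fin n} (h : localPos c i = localPos c m) (hm : i < m) :
    ∃ j, IsPred c i j ∧ j ≤ m := by
  classical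
  obtain ⟨j, hj, hmin⟩ := Finset.exists_min_image
    (Finset.univ.filter fun j => localPos c i = localPos c j ∧ i < j) id ⟨m, by simp [h, hm]⟩
  simp only [Finset.mem_filter, Finset.mem_univ, true_and, id] at hj hmin
  refine ⟨j, ⟨hj.1, hj.2, fun a ha ha' => ?_⟩, hmin m ⟨h, hm⟩⟩
  by_contra hlt
  exact absurd (hmin a ⟨hj.1.trans ha.symm, not_le.1 hlt⟩) (not_le.2 ha')

variable (K : Type*) [Field K]

variable (c) in
open Classical in
/-- A Richardson element of the nilradical: the matrix that maps each basis vector to the last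
earlier one with the same position within its block. -/
noncomputable def richardson : Matrix (Fin n) (Fin n) K :=
  Matrix.of fun i j => if IsPred c i j then 1 else 0

theorem richardson_mem : richardson c K ∈ nilradical K c := by
  intro i j hij
  simp only [richardson, Matrix.of_apply, ite_eq_right_iff, one_ne_zero, imp_false]
  exact fun h => hij h.index_lt

theorem single_one_mul_apply (a b : Fin n) (x : Matrix (Fin n) (Fin n) K) (i j : Fin n) :
    (Matrix.single a b (1 : K) * x) i j = if a = i then x b j else 0 := by
  split_ifs with h
  · subst h; simp
  · exact Matrix.single_mul_apply_of_ne _ _ _ _ _ (Ne.symm h) _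

theorem mul_single_one_apply (a b : Fin n) (x : Matrix (Fin n) (Fin n) K) (i j : Fin n) :
    (x * Matrix.single a b (1 : K)) i j = if b = j then x i a else 0 := by
  split_ifs with h
  · subst h; simp
  · exact Matrix.mul_single_apply_of_ne _ _ _ _ _ (Ne.symm h) _

theorem single_mul_richardson {a b j : Fin n} (h : IsPred c b j) :
    Matrix.single a b 1 * richardson c K = Matrix.single a j 1 := by
  ext i k
  rw [single_one_mul_apply, Matrix.single_apply]
  by_cases hi : a = i
  · by_cases hk : j = k
    · subst hi hk; simp [richardson, h]
    · have : ¬ IsPred c b k := fun h' => hk (h.right_unique h')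
      simp [richardson, hk, this]
  · simp [hi]

theorem single_mul_richardson_eq_zero {a b : Fin n} (h : ∀ j, ¬ IsPred c b j) :
    Matrix.single a b 1 * richardson c K = 0 := by
  ext i k
  rw [single_one_mul_apply]
  simp [richardson, h]

theorem richardson_mul_single {i a b : Fin n} (h : IsPred c i a) :
    richardson c K * Matrix.single a b 1 = Matrix.single i b 1 := by
  ext k l
  rw [mul_single_one_apply, Matrix.single_apply]
  by_cases hl : b = l
  · by_cases hk : i = k
    · subst hl hk; simp [richardson, h]
    · have : ¬ IsPred c k a := fun h' => hk (h.left_unique h')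
      simp [richardson, hk, this]
  · simp [hl]

theorem richardson_mul_single_eq_zero {a b : Fin n} (h : ∀ i, ¬ IsPred c i a) :
    richardson c K * Matrix.single a b 1 = 0 := by
  ext i k
  rw [mul_single_one_apply]
  simp [richardson, h]

theorem blockTriangular_single {a b : Fin n} (h : c.index a ≤ c.index b) :
    (Matrix.single a b (1 : K)).BlockTriangular c.index := by
  intro i j hij
  refine Matrix.single_apply_of_ne _ _ _ _ _ ?_
  rintro ⟨rfl, rfl⟩
  exact absurd hij (not_lt.2 h)

/-- With `b'` the predecessor of `b` and `i` that of `a`, the commutator of `E_{a,b'}` is `E_{a,b} -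
E_{i,b'}`; recursion along predecessors removes the second term, which is absent if `a` has none.
The inequality of local positions gives the block of `a` an index with the local position of `b`, so
`b'` exists and does not lie in a block before that of `a`. -/
theorem exists_commutator_richardson_of_ge (m : ℕ) : ∀ a b : Fin n, (a : ℕ) < m →
    c.index a < c.index b → localPos c b ≤ localPos c a →
    ∃ W : Matrix (Fin n) (Fin n) K, W.BlockTriangular c.index ∧
      W * richardson c K - richardson c K * W = Matrix.single a b 1 := by
  induction m with
  | zero => intro a b h; omega
  | succ m ih =>
    intro a b ha hab hp
    obtain ⟨a', ha', hp'⟩ := exists_localPos_eq hp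
    obtain ⟨b', hb', hle⟩ := exists_isPred_left hp' (lt_of_index_lt (ha' ▸ hab))
    have hab' : c.index a ≤ c.index b' := ha' ▸ index_mono hle
    by_cases h : ∃ i, IsPred c i a
    · obtain ⟨i, hi⟩ := h
      have hia : (i : ℕ) < a := hi.2.1
      obtain ⟨W, hW, e⟩ := ih i b' (by omega) (hi.index_lt.trans_le hab')
        (by rw [hi.1, hb'.1]; exact hp)
      refine ⟨Matrix.single a b' 1 + W, (blockTriangular_single K hab').add hW, ?_⟩
      rw [add_mul, mul_add, add_sub_add_comm, e, single_mul_richardson K hb',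
        richardson_mul_single K hi, sub_add_cancel]
    · push Not at h
      refine ⟨Matrix.single a b' 1, blockTriangular_single K hab', ?_⟩
      rw [single_mul_richardson K hb', richardson_mul_single_eq_zero K h, sub_zero]

/-- The mirror image of `exists_commutator_richardson_of_ge`: the recursion runs along successors,
towards later columns. -/
theorem exists_commutator_richardson_of_le (m : ℕ) : ∀ a b : Fin n, n - (b : ℕ) < m →
    c.index a < c.index b → localPos c a ≤ localPos c b →
    ∃ W : Matrix (Fin n) (Fin n) K, W.BlockTriangular c.index ∧
      W * richardson c K - richardson c K * W = Matrix.single a b 1 := by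
  induction m with
  | zero => intro a b h; omega
  | succ m ih =>
    intro a b hb hab hp
    obtain ⟨b', hb', hp'⟩ := exists_localPos_eq hp
    obtain ⟨a', ha', hle⟩ := exists_isPred_right hp'.symm (lt_of_index_lt (hb' ▸ hab))
    have hab' : c.index a' ≤ c.index b := hb' ▸ index_mono hle
    by_cases h : ∃ j, IsPred c b j
    · obtain ⟨j, hj⟩ := h
      have hbj : (b : ℕ) < j := hj.2.1
      have hbn := b.2
      obtain ⟨W, hW, e⟩ := ih a' j (by omega) (hab'.trans_lt hj.index_lt)
        (by rw [← ha'.1, ← hj.1]; exact hp)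
      refine ⟨W - Matrix.single a' b 1, hW.sub (blockTriangular_single K hab'), ?_⟩
      rw [sub_mul, mul_sub, sub_sub_sub_comm, e, single_mul_richardson K hj,
        richardson_mul_single K ha', sub_sub_cancel]
    · push Not at h
      refine ⟨-Matrix.single a' b 1, (blockTriangular_single K hab').neg, ?_⟩
      rw [neg_mul, mul_neg, single_mul_richardson_eq_zero K h, richardson_mul_single K ha']
      simp

theorem exists_commutator_richardson {a b : Fin n} (h : c.index a < c.index b) :
    ∃ W : Matrix (Fin n) (Fin n) K, W.BlockTriangular c.index ∧
      W * richardson c K - richardson c K * W = Matrix.single a b 1 :=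
  (le_total (localPos c b) (localPos c a)).elim
    (exists_commutator_richardson_of_ge K (a + 1) a b (Nat.lt_succ_self _) h)
    (exists_commutator_richardson_of_le K (n - b + 1) a b (Nat.lt_succ_self _) h)

end Richardson

/-! ### The open conditions: base pivots and surjective commutators. -/

section Generic

variable {n : ℕ} {c : Composition n} {K : Type*} [Field K]

theorem mul_mem_nilradical_right {p x : Matrix (Fin n) (Fin n) K}
    (hp : p.BlockTriangular c.index) (hx : x ∈ nilradical K c) : x * p ∈ nilradical K c := by
  intro i j hij
  rw [Matrix.mul_apply]
  refine Finset.sum_eq_zero fun k _ => ?_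
  by_cases h : c.index j < c.index k
  · rw [hp h, mul_zero]
  · rw [hx i k fun hk => hij (lt_of_lt_of_le hk (not_lt.1 h)), zero_mul]

/-- The last nonzero coordinate of `v` is the one at `i`. -/
def LeadsAt (v : Fin n → K) (i : Fin n) : Prop := v i ≠ 0 ∧ ∀ a, i < a → v a = 0

variable (c) in
/-- The pivots of the span of each initial segment of columns of `x` are the rows of the base
positions in these columns. -/
def HasBasePivots (x : Matrix (Fin n) (Fin n) K) : Prop :=
  ∀ i q, (∃ v : Fin n → K, (∀ a, q < a → v a = 0) ∧ LeadsAt (x *ᵥ v) i) ↔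
    ∃ j ≤ q, (i, j) ∈ base c

variable (c) in
/-- The orbit of `x` under the parabolic subgroup has the whole nilradical as tangent space. -/
def IsRichardson (x : Matrix (Fin n) (Fin n) K) : Prop :=
  ∀ N ∈ nilradical K c, ∃ W : Matrix (Fin n) (Fin n) K,
    W.BlockTriangular c.index ∧ W * x - x * W = N

variable (c) in
/-- The base positions weakly below row `i` and weakly to the left of column `q`. -/
abbrev BaseCorner (i q : Fin n) : Type :=
  {ξ : Fin n × Fin n // ξ ∈ base c ∧ i ≤ ξ.1 ∧ ξ.2 ≤ q}

noncomputable instance (i q : Fin n) : Fintype (BaseCorner c i q) := Fintype.ofFinite _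

noncomputable instance : Fintype (nilRoots c) := Fintype.ofFinite _

variable (c) in
open scoped Classical in
/-- The minor of `x` on the rows and the columns of the base positions in a lower left corner. -/
noncomputable def baseMinor {R : Type*} [CommRing R] (x : Matrix (Fin n) (Fin n) R)
    (i q : Fin n) : R :=
  (Matrix.of fun ξ η : BaseCorner c i q => x ξ.1.1 η.1.2).det

theorem map_baseMinor {R R' : Type*} [CommRing R] [CommRing R'] (f : R →+* R')
    (x : Matrix (Fin n) (Fin n) R) (i q : Fin n) :
    f (baseMinor c x i q) = baseMinor c (x.map f) i q := by
  unfold baseMinor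
  rw [RingHom.map_det]
  rfl

/-- Invertibility of the minor yields a combination of base columns that is a unit vector on the
base rows of the corner. The other rows below `i` vanish on all columns used. -/
theorem exists_leadsAt_of_baseMinor_ne_zero {x : Matrix (Fin n) (Fin n) K}
    (hx : x ∈ nilradical K c) {i q : Fin n} (hiq : (i, q) ∈ base c)
    (hdet : baseMinor c x i q ≠ 0) :
    ∃ v : Fin n → K, (∀ a, q < a → v a = 0) ∧ LeadsAt (x *ᵥ v) i := by
  classical
  set D : Matrix (BaseCorner c i q) (BaseCorner c i q) K :=
    Matrix.of fun ξ η => x ξ.1.1 η.1.2 with hD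
  have hunit : IsUnit D.det := by
    unfold baseMinor at hdet
    refine isUnit_iff_ne_zero.2 ?_
    convert hdet
  let o : BaseCorner c i q := ⟨(i, q), hiq, le_rfl, le_rfl⟩
  set y : BaseCorner c i q → K := D⁻¹ *ᵥ Pi.single o 1 with hy
  have hDy : D *ᵥ y = Pi.single o 1 := by
    rw [hy, Matrix.mulVec_mulVec, Matrix.mul_nonsing_inv _ hunit, Matrix.one_mulVec]
  set v : Fin n → K := ∑ η, y η • Pi.single η.1.2 1 with hv
  have hxv : ∀ a, (x *ᵥ v) a = ∑ η, x a η.1.2 * y η := by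
    intro a
    rw [hv, Matrix.mulVec_sum, Finset.sum_apply]
    refine Finset.sum_congr rfl fun η _ => ?_
    rw [Matrix.mulVec_smul]
    simp [mul_comm]
  have hrow : ∀ ξ : BaseCorner c i q, (x *ᵥ v) ξ.1.1 = Pi.single (M := fun _ => K) o 1 ξ := by
    intro ξ
    rw [hxv, ← hDy]
    rfl
  refine ⟨v, fun a ha => ?_, ?_, fun a ha => ?_⟩
  · rw [hv, Finset.sum_apply]
    refine Finset.sum_eq_zero fun η _ => ?_
    have : a ≠ η.1.2 := fun e => absurd ha (not_lt.2 (e ▸ η.2.2.2))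
    simp [this]
  · have := hrow o
    rw [show i = o.1.1 from rfl, this]
    simp
  · by_cases h : ∃ j ≤ q, (a, j) ∈ base c
    · obtain ⟨j, hj, haj⟩ := h
      have := hrow ⟨(a, j), haj, ha.le, hj⟩
      rw [show a = (a, j).1 from rfl, this, Pi.single_apply, if_neg]
      intro e
      exact ha.ne' (congrArg (fun ξ : BaseCorner c i q => ξ.1.1) e)
    · rw [hxv]
      refine Finset.sum_eq_zero fun η _ => ?_
      rw [hx, zero_mul]
      intro hlt
      have hlt' : c.index a < c.index q := lt_of_lt_of_le hlt (index_mono η.2.2.2)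
      -- A nonzero entry would put `(a, q)` in the nilradical. It cannot be covered from below,
      -- since the base position of column `q` is in row `i`, above `a`.
      rcases base_cover hlt' with h1 | ⟨j, hj, h1⟩ | ⟨i', hi', h1⟩
      · exact h ⟨q, le_rfl, h1⟩
      · exact h ⟨j, hj.le, h1⟩
      · exact (ha.trans hi').ne (base_col_unique hiq h1)

/-- No pivots arise besides the prescribed ones: the last column is eliminated with the vector that
leads at its base position. A column without base position adds no pivot, because `base_cover` then
finds one further left in the row. -/
theorem exists_base_of_leadsAt {x : Matrix (Fin n) (Fin n) K} (hx : x ∈ nilradical K c)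
    (hlead : ∀ i q, (i, q) ∈ base c →
      ∃ v : Fin n → K, (∀ a, q < a → v a = 0) ∧ LeadsAt (x *ᵥ v) i) (m : ℕ) :
    ∀ (v : Fin n → K) (i : Fin n), (∀ a : Fin n, m ≤ a → v a = 0) → LeadsAt (x *ᵥ v) i →
      ∃ j : Fin n, (j : ℕ) < m ∧ (i, j) ∈ base c := by
  induction m with
  | zero =>
    intro v i hv h
    have : v = 0 := funext fun a => hv a (Nat.zero_le _)
    exact absurd (by simp [this]) h.1
  | succ m ih =>
    intro v i hv h
    by_cases hm : m < n
    swap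
    · obtain ⟨j, hj, hij⟩ := ih v i (fun a ha => absurd a.2 (by omega)) h
      exact ⟨j, by omega, hij⟩
    set q : Fin n := ⟨m, hm⟩ with hq
    have hred : ∀ u : Fin n → K, (∀ a : Fin n, m + 1 ≤ a → u a = 0) → u q = 0 →
        ∀ a : Fin n, m ≤ a → u a = 0 := by
      intro u hu huq a ha
      rcases ha.eq_or_lt with e | e
      · rw [← huq]; congr 1; exact Fin.ext e.symm
      · exact hu a e
    by_cases hcol : ∃ i₀, (i₀, q) ∈ base c
    · obtain ⟨i₀, hi₀⟩ := hcol
      obtain ⟨w, hw, hw'⟩ := hlead i₀ q hi₀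
      have hw1 : ∀ a : Fin n, m + 1 ≤ a → w a = 0 := fun a ha => hw a (Fin.lt_def.2 ha)
      have hno : ¬ ∃ j : Fin n, (j : ℕ) < m ∧ (i₀, j) ∈ base c := by
        rintro ⟨j, hj, hij⟩
        rw [base_row_unique hij hi₀] at hj
        exact lt_irrefl _ hj
      -- Otherwise `i₀` would be a pivot of the columns before `q`, and row `i₀` would hold two base
      -- positions.
      have hwq : w q ≠ 0 := fun hwq => hno (ih w i₀ (hred w hw1 hwq) hw')
      set α := v q / w q with hα
      have hu := hred (v - α • w)
        (fun a ha => by rw [Pi.sub_apply, Pi.smul_apply, hv a ha, hw1 a ha]; simp)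
        (by rw [Pi.sub_apply, Pi.smul_apply, hα, smul_eq_mul, div_mul_cancel₀ _ hwq, sub_self])
      have hxu : ∀ a, (x *ᵥ (v - α • w)) a = (x *ᵥ v) a - α * (x *ᵥ w) a := fun a => by
        rw [Matrix.mulVec_sub, Matrix.mulVec_smul]; rfl
      rcases lt_trichotomy i i₀ with hlt | rfl | hgt
      · by_cases hα0 : α = 0
        · have : v q = 0 := by
            rw [hα, div_eq_zero_iff] at hα0
            exact hα0.resolve_right hwq
          obtain ⟨j, hj, hij⟩ := ih v i (hred v hv this) h
          exact ⟨j, by omega, hij⟩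
        · refine absurd (ih _ i₀ hu ⟨?_, fun a ha => ?_⟩) hno
          · rw [hxu, h.2 _ hlt, zero_sub, neg_ne_zero]
            exact mul_ne_zero hα0 hw'.1
          · rw [hxu, h.2 _ (hlt.trans ha), hw'.2 _ ha]; simp
      · exact ⟨q, Nat.lt_succ_self m, hi₀⟩
      · obtain ⟨j, hj, hij⟩ := ih _ i hu ⟨by rw [hxu, hw'.2 _ hgt]; simpa using h.1,
          fun a ha => by rw [hxu, h.2 _ ha, hw'.2 _ (hgt.trans ha)]; simp⟩
        exact ⟨j, by omega, hij⟩
    · have hlt : c.index i < c.index q := by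
        by_contra hge
        refine h.1 ?_
        rw [Matrix.mulVec, dotProduct]
        refine Finset.sum_eq_zero fun a _ => ?_
        by_cases ha : m + 1 ≤ a
        · rw [hv a ha, mul_zero]
        · rw [hx, zero_mul]
          exact fun hia => hge (lt_of_lt_of_le hia (index_mono (Fin.le_def.2 (by
            change (a : ℕ) ≤ m; omega))))
      rcases base_cover hlt with h1 | ⟨j, hj, h1⟩ | ⟨i', -, h1⟩
      · exact absurd ⟨i, h1⟩ hcol
      · exact ⟨j, Nat.lt_succ_of_lt hj, h1⟩
      · exact absurd ⟨i', h1⟩ hcol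

theorem hasBasePivots_of_baseMinor_ne_zero {x : Matrix (Fin n) (Fin n) K}
    (hx : x ∈ nilradical K c) (h : ∀ i q, (i, q) ∈ base c → baseMinor c x i q ≠ 0) :
    HasBasePivots c x := by
  have hlead := fun i q hiq => exists_leadsAt_of_baseMinor_ne_zero hx hiq (h i q hiq)
  intro i q
  constructor
  · rintro ⟨v, hv, hl⟩
    obtain ⟨j, hj, hij⟩ := exists_base_of_leadsAt hx hlead (q + 1) v i
      (fun a ha => hv a (Fin.lt_def.2 ha)) hl
    exact ⟨j, Fin.le_def.2 (Nat.lt_succ_iff.1 hj), hij⟩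
  · rintro ⟨j, hj, hij⟩
    obtain ⟨v, hv, hl⟩ := hlead i j hij
    exact ⟨v, fun a ha => hv a (lt_of_le_of_lt hj ha), hl⟩

variable (c K) in
open scoped Classical in
/-- The matrix with ones at the base positions and zeros elsewhere. -/
noncomputable def baseMatrix : Matrix (Fin n) (Fin n) K :=
  Matrix.of fun i j => if (i, j) ∈ base c then 1 else 0

theorem baseMatrix_mem : baseMatrix c K ∈ nilradical K c := by
  intro i j hij
  simp only [baseMatrix, Matrix.of_apply, ite_eq_right_iff, one_ne_zero, imp_false]
  exact fun h => hij (index_lt_of_mem_base h)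

/-- The base has at most one position in each row and column, so the submatrix is the identity. -/
theorem baseMinor_baseMatrix (i q : Fin n) : baseMinor c (baseMatrix c K) i q = 1 := by
  classical
  unfold baseMinor
  convert Matrix.det_one (n := BaseCorner c i q) (R := K)
  ext ξ η
  rw [Matrix.one_apply]
  simp only [baseMatrix, Matrix.of_apply]
  refine if_congr ⟨fun h => ?_, fun h => ?_⟩ rfl rfl
  · exact Subtype.ext (Prod.ext (base_col_unique h η.2.1) (base_row_unique ξ.2.1 h))
  · subst h; exact ξ.2.1

/-! The generic element of the nilradical. -/

variable (c K) in
open scoped Classical in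
/-- The matrix of the coordinate functions on the nilradical. -/
noncomputable def genericMatrix : Matrix (Fin n) (Fin n) (MvPolynomial (nilRoots c) K) :=
  Matrix.of fun i j => if h : (i, j) ∈ nilRoots c then MvPolynomial.X ⟨(i, j), h⟩ else 0

theorem genericMatrix_map_aeval (x : nilradical K c) :
    (genericMatrix c K).map (MvPolynomial.aeval (coords x) :
      MvPolynomial (nilRoots c) K →ₐ[K] K).toRingHom = x := by
  ext i j
  by_cases h : (i, j) ∈ nilRoots c
  · simp [genericMatrix, h, coords]
  · simp [genericMatrix, h, x.2 i j h]

variable (c) in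
open scoped Classical in
/-- The determinant of the map that sends the coordinates `t` to the coordinates on the nilradical
of the commutator of `∑ t δ • W δ` and `x`. -/
noncomputable def commutatorDet {R : Type*} [CommRing R]
    (W : nilRoots c → Matrix (Fin n) (Fin n) R) (x : Matrix (Fin n) (Fin n) R) : R :=
  (Matrix.of fun γ δ : nilRoots c => (W δ * x - x * W δ) γ.1.1 γ.1.2).det

theorem map_commutatorDet {R R' : Type*} [CommRing R] [CommRing R'] (f : R →+* R')
    (W : nilRoots c → Matrix (Fin n) (Fin n) R) (x : Matrix (Fin n) (Fin n) R) :
    f (commutatorDet c W x) = commutatorDet c (fun δ => (W δ).map f) (x.map f) := by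
  unfold commutatorDet
  rw [RingHom.map_det]
  congr 1
  ext γ δ
  simp [← Matrix.map_mul]

theorem isRichardson_of_commutatorDet_ne_zero {x : Matrix (Fin n) (Fin n) K}
    (hx : x ∈ nilradical K c) {W : nilRoots c → Matrix (Fin n) (Fin n) K}
    (hW : ∀ δ, (W δ).BlockTriangular c.index) (hdet : commutatorDet c W x ≠ 0) :
    IsRichardson c x := by
  classical
  intro N hN
  set D : Matrix (nilRoots c) (nilRoots c) K :=
    Matrix.of fun γ δ => (W δ * x - x * W δ) γ.1.1 γ.1.2 with hD
  have hunit : IsUnit D.det := by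
    unfold commutatorDet at hdet
    refine isUnit_iff_ne_zero.2 ?_
    convert hdet
  set t : nilRoots c → K := D⁻¹ *ᵥ fun γ => N γ.1.1 γ.1.2 with ht
  have hDt : D *ᵥ t = fun γ => N γ.1.1 γ.1.2 := by
    rw [ht, Matrix.mulVec_mulVec, Matrix.mul_nonsing_inv _ hunit, Matrix.one_mulVec]
  have hsum : (∑ δ, t δ • W δ).BlockTriangular c.index := by
    intro i j hij
    rw [Matrix.sum_apply]
    exact Finset.sum_eq_zero fun δ _ => by rw [Matrix.smul_apply, hW δ hij, smul_zero]
  refine ⟨∑ δ, t δ • W δ, hsum, ?_⟩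
  ext i j
  by_cases hij : (i, j) ∈ nilRoots c
  · have := congrFun hDt ⟨(i, j), hij⟩
    rw [← this, Finset.sum_mul, Finset.mul_sum, ← Finset.sum_sub_distrib, Matrix.sum_apply]
    refine Finset.sum_congr rfl fun δ _ => ?_
    rw [Matrix.smul_mul, Matrix.mul_smul, ← smul_sub, Matrix.smul_apply, smul_eq_mul, mul_comm]
    rfl
  · rw [hN i j hij]
    exact sub_mem (mul_mem_nilradical hsum hx) (mul_mem_nilradical_right hsum hx) i j hij

theorem commutatorDet_richardson {W : nilRoots c → Matrix (Fin n) (Fin n) K}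
    (hW : ∀ δ, W δ * richardson c K - richardson c K * W δ =
      Matrix.single δ.1.1 δ.1.2 1) : commutatorDet c W (richardson c K) = 1 := by
  classical
  unfold commutatorDet
  convert Matrix.det_one (n := nilRoots c) (R := K)
  ext γ δ
  rw [Matrix.one_apply]
  simp only [Matrix.of_apply, hW, Matrix.single_apply]
  refine if_congr ⟨fun h => ?_, fun h => ?_⟩ rfl rfl
  · exact Subtype.ext (Prod.ext h.1.symm h.2.symm)
  · subst h; exact ⟨rfl, rfl⟩

variable (c K) in
/-- The elements with base pivots that are Richardson elements contain a nonempty open set. -/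
theorem exists_isZariskiOpen_generic [Infinite K] : ∃ V : Set (nilradical K c),
    V.Nonempty ∧ IsZariskiOpen V ∧ ∀ x ∈ V,
      HasBasePivots c (x : Matrix (Fin n) (Fin n) K) ∧
      IsRichardson c (x : Matrix (Fin n) (Fin n) K) := by
  classical
  -- The `W δ` are chosen once, for the Richardson element, and stay constant as `x` varies; hence
  -- `f₁` is a polynomial in the coordinates of `x`.
  choose W hWB hW using fun δ : nilRoots c => exists_commutator_richardson (c := c) K δ.2
  let ev (x : nilradical K c) : MvPolynomial (nilRoots c) K →+* K :=
    (MvPolynomial.aeval (coords x) : MvPolynomial (nilRoots c) K →ₐ[K] K).toRingHom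
  let f₁ : MvPolynomial (nilRoots c) K :=
    commutatorDet c (fun δ => (W δ).map MvPolynomial.C) (genericMatrix c K)
  let f₂ : MvPolynomial (nilRoots c) K :=
    ∏ ξ ∈ Finset.univ.filter (· ∈ base c), baseMinor c (genericMatrix c K) ξ.1 ξ.2
  have ev₁ : ∀ x, ev x f₁ = commutatorDet c W x := by
    intro x
    rw [map_commutatorDet, genericMatrix_map_aeval]
    congr 1
    ext δ i j
    simp [ev]
  have ev₂ : ∀ x, ev x f₂ =
      ∏ ξ ∈ Finset.univ.filter (· ∈ base c), baseMinor c x.1 ξ.1 ξ.2 := by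
    intro x
    rw [map_prod]
    refine Finset.prod_congr rfl fun ξ _ => ?_
    rw [map_baseMinor, genericMatrix_map_aeval]
  have h₁ : f₁ ≠ 0 := by
    intro h
    have := ev₁ ⟨richardson c K, richardson_mem K⟩
    rw [commutatorDet_richardson hW, h, map_zero] at this
    exact zero_ne_one this
  have h₂ : f₂ ≠ 0 := by
    intro h
    have := ev₂ ⟨baseMatrix c K, baseMatrix_mem⟩
    simp only [baseMinor_baseMatrix, Finset.prod_const_one] at this
    rw [h, map_zero] at this
    exact zero_ne_one this
  have hf : f₁ * f₂ ≠ 0 := mul_ne_zero h₁ h₂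
  refine ⟨{x | ev x (f₁ * f₂) ≠ 0}, ?_, ⟨Ideal.span {f₁ * f₂}, ?_⟩, fun x hx => ?_⟩
  · obtain ⟨p, hp⟩ : ∃ p, MvPolynomial.eval p (f₁ * f₂) ≠ 0 := by
      by_contra! h
      exact hf (MvPolynomial.funext fun p => by rw [h p, map_zero])
    refine ⟨⟨Matrix.of fun i j => if h : (i, j) ∈ nilRoots c then p ⟨(i, j), h⟩ else 0,
      fun i j h => by simp [h]⟩, ?_⟩
    change MvPolynomial.aeval _ _ ≠ 0
    rw [MvPolynomial.aeval_eq_eval]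
    convert hp
    ext γ
    simp [coords]
  · ext x
    simp only [Set.mem_ofPred_eq, MvPolynomial.mem_zeroLocus_iff, not_iff_not]
    constructor
    · intro h p hp
      obtain ⟨a, rfl⟩ := Ideal.mem_span_singleton'.1 hp
      rw [map_mul]
      exact mul_eq_zero_of_right _ h
    · exact fun h => h _ (Ideal.mem_span_singleton_self _)
  · rw [Set.mem_ofPred_eq, map_mul, ev₁, ev₂, mul_ne_zero_iff, Finset.prod_ne_zero_iff] at hx
    exact ⟨hasBasePivots_of_baseMinor_ne_zero x.2 fun i q h => hx.2 (i, q) (by simpa using h),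
      isRichardson_of_commutatorDet_ne_zero x.2 hWB hx.1⟩

end Generic

/-! ### Uniqueness: conjugate elements of the section are equal. -/

section Uniqueness

variable {n : ℕ} {c : Composition n} {K : Type*} [Field K]

variable (c K) in
/-- The vectors supported on the first `k` blocks. -/
def blockSpan (k : ℕ) : Submodule K (Fin n → K) where
  carrier := {v | ∀ a, k ≤ (c.index a : ℕ) → v a = 0}
  add_mem' := by
    intro v w hv hw a ha
    rw [Pi.add_apply, hv a ha, hw a ha, add_zero]
  zero_mem' := fun _ _ => rfl
  smul_mem' := by
    intro t v hv a ha
    rw [Pi.smul_apply, hv a ha, smul_zero]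

theorem blockSpan_mono {k l : ℕ} (h : k ≤ l) : blockSpan c K k ≤ blockSpan c K l :=
  fun _ hv a ha => hv a (h.trans ha)

theorem single_mem_blockSpan {k : ℕ} {a : Fin n} (h : (c.index a : ℕ) < k) :
    Pi.single a (1 : K) ∈ blockSpan c K k := by
  intro b hb
  rw [Pi.single_apply, if_neg]
  rintro rfl
  exact absurd h (not_lt.2 hb)

theorem mulVec_mem_blockSpan {x : Matrix (Fin n) (Fin n) K} (hx : x ∈ nilradical K c) {k : ℕ}
    {v : Fin n → K} (hv : v ∈ blockSpan c K (k + 1)) : x *ᵥ v ∈ blockSpan c K k := by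
  intro a ha
  rw [Matrix.mulVec, dotProduct]
  refine Finset.sum_eq_zero fun b _ => ?_
  by_cases hb : k + 1 ≤ (c.index b : ℕ)
  · rw [hv b hb, mul_zero]
  · rw [hx, zero_mul]
    intro hab
    have : (c.index a : ℕ) < c.index b := hab
    omega

theorem mulVec_mem_blockSpan_self {x : Matrix (Fin n) (Fin n) K} (hx : x ∈ nilradical K c)
    {k : ℕ} {v : Fin n → K} (hv : v ∈ blockSpan c K k) : x *ᵥ v ∈ blockSpan c K k :=
  mulVec_mem_blockSpan hx (blockSpan_mono (Nat.le_succ k) hv)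

theorem eq_sum_smul_single (v : Fin n → K) : v = ∑ b, v b • Pi.single b (1 : K) :=
  pi_eq_sum_univ' v

theorem blockSpan_le {k : ℕ} {Q : Submodule K (Fin n → K)}
    (h : ∀ a, (c.index a : ℕ) < k → Pi.single a 1 ∈ Q) : blockSpan c K k ≤ Q := by
  intro v hv
  rw [eq_sum_smul_single v]
  refine Submodule.sum_mem _ fun b _ => ?_
  by_cases hb : (c.index b : ℕ) < k
  · exact Q.smul_mem _ (h b hb)
  · rw [hv b (not_lt.1 hb), zero_smul]
    exact Q.zero_mem

theorem exists_leadsAt {v : Fin n → K} {i : Fin n} (h : v i ≠ 0) :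
    ∃ i₁, i ≤ i₁ ∧ LeadsAt v i₁ := by
  classical
  obtain ⟨i₁, h₁, hmax⟩ := Finset.exists_max_image
    (Finset.univ.filter fun a => v a ≠ 0) id ⟨i, by simp [h]⟩
  simp only [Finset.mem_filter, Finset.mem_univ, true_and, id] at h₁ hmax
  refine ⟨i₁, hmax i h, h₁, fun a ha => ?_⟩
  by_contra hne
  exact absurd (hmax a hne) (not_le.2 ha)

theorem exists_ne_zero_of_leadsAt_mulVec {x : Matrix (Fin n) (Fin n) K} {w : Fin n → K}
    {i : Fin n} (h : LeadsAt (x *ᵥ w) i) : ∃ a, w a ≠ 0 := by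
  by_contra! hw
  exact h.1 (by rw [show w = 0 from funext hw, Matrix.mulVec_zero]; rfl)

theorem HasBasePivots.exists_base {x : Matrix (Fin n) (Fin n) K} (hp : HasBasePivots c x)
    {w : Fin n → K} {i : Fin n} (h : LeadsAt (x *ᵥ w) i) :
    ∃ j q, j ≤ q ∧ w q ≠ 0 ∧ (i, j) ∈ base c := by
  obtain ⟨a, ha⟩ := exists_ne_zero_of_leadsAt_mulVec h
  obtain ⟨q, -, hq⟩ := exists_leadsAt ha
  obtain ⟨j, hj, hij⟩ := (hp i q).1 ⟨w, hq.2, h⟩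
  exact ⟨j, q, hj, hq.1, hij⟩

theorem HasBasePivots.exists_base_of_mem_blockSpan {x : Matrix (Fin n) (Fin n) K}
    (hp : HasBasePivots c x) {k : ℕ} {w : Fin n → K} (hw : w ∈ blockSpan c K k) {i : Fin n}
    (h : LeadsAt (x *ᵥ w) i) : ∃ j, (c.index j : ℕ) < k ∧ (i, j) ∈ base c := by
  obtain ⟨j, q, hjq, hq, hij⟩ := hp.exists_base h
  refine ⟨j, lt_of_le_of_lt (show (c.index j : ℕ) ≤ c.index q from index_mono hjq) ?_, hij⟩
  by_contra hlt
  exact hq (hw q (not_lt.1 hlt))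

/-- Let `1 + N` conjugate `z` to `z'`, both in the section, where the columns of the first `k`
blocks agree and the next block of columns agrees below the block `l` of rows. If a position of
the broad base lies in these blocks, then `N` maps the span of the first `k` blocks to the span
of the first `l` blocks, modulo the image under `z` of the former. -/
theorem single_mem_comap_of_section {z z' N : Matrix (Fin n) (Fin n) K}
    (hp : HasBasePivots c z) (hz : ∀ i j, (i, j) ∉ broadBase c → z i j = 0)
    (hz' : ∀ i j, (i, j) ∉ broadBase c → z' i j = 0) (hN : N ∈ nilradical K c) {k l : ℕ}
    (hcomm : ∀ v ∈ blockSpan c K k, N *ᵥ (z *ᵥ v) = z *ᵥ (N *ᵥ v))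
    (hcol : ∀ j, (c.index j : ℕ) = k → N *ᵥ (z *ᵥ Pi.single j 1) =
      z' *ᵥ Pi.single j 1 - z *ᵥ Pi.single j 1 + z *ᵥ (N *ᵥ Pi.single j 1))
    (hrows : ∀ i j, (c.index j : ℕ) = k → l < (c.index i : ℕ) → z i j = z' i j)
    {i j : Fin n} (hi : (c.index i : ℕ) = l) (hj : (c.index j : ℕ) = k)
    (hij : (i, j) ∈ broadBase c) (m : ℕ) :
    ∀ a : Fin n, (a : ℕ) < m → (c.index a : ℕ) < k → Pi.single a (1 : K) ∈
      (blockSpan c K l ⊔ (blockSpan c K k).map z.mulVecLin).comap N.mulVecLin := by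
  set Q := (blockSpan c K l ⊔ (blockSpan c K k).map z.mulVecLin).comap N.mulVecLin with hQ
  have hW : ∀ v ∈ blockSpan c K k,
      z *ᵥ v ∈ blockSpan c K l ⊔ (blockSpan c K k).map z.mulVecLin := fun v hv =>
    Submodule.mem_sup_right ⟨v, hv, rfl⟩
  induction m with
  | zero => intro a ha; omega
  | succ m ih =>
    intro a ham hak
    by_cases hal : (c.index a : ℕ) ≤ l
    · exact Submodule.mem_sup_left
        (mulVec_mem_blockSpan hN (single_mem_blockSpan (Nat.lt_succ_of_le hal)))
    rw [not_le] at hal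
    obtain ⟨j', hj', haj'⟩ : ∃ j' < j, (a, j') ∈ base c := by
      -- A base position in column `j` at or below row `a` would, together with the broad base
      -- position `(i, j)`, force the block of `a` to be at most `l`.
      rcases base_cover (c := c) (i := a) (j := j) (Fin.lt_def.2 (hj ▸ hak)) with h | h | ⟨i', hi', h⟩
      · have : (c.index a : ℕ) ≤ c.index i := index_le_of_mem_base_of_mem_broadBase hij h
        omega
      · exact h
      · have h1 : (c.index i' : ℕ) ≤ c.index i := index_le_of_mem_base_of_mem_broadBase hij h
        have h2 : (c.index a : ℕ) ≤ c.index i' := index_mono (le_of_lt hi')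
        omega
    obtain ⟨v, hv, hlead⟩ := (hp a j').2 ⟨j', le_rfl, haj'⟩
    have hbcol : ∀ b, b ≤ j' → z *ᵥ Pi.single b 1 ∈ Q := by
      intro b hb
      have hbk : (c.index b : ℕ) ≤ k := hj ▸ (index_mono (hb.trans hj'.le))
      rcases hbk.lt_or_eq with hbk | hbk
      · have hb' := single_mem_blockSpan (K := K) hbk
        rw [hQ, Submodule.mem_comap, Matrix.mulVecLin_apply, hcomm _ hb']
        exact hW _ (mulVec_mem_blockSpan_self hN hb')
      -- The base position of column `b` lies below the block `l`, so all broad base positions of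
      -- this column do too; there `z` and `z'` agree, hence the whole columns coincide.
      · obtain ⟨i₅, hi₅, hS⟩ : ∃ i₅, a ≤ i₅ ∧ (i₅, b) ∈ base c := by
          rcases base_cover (c := c) (i := a) (j := b) (Fin.lt_def.2 (hbk ▸ hak)) with
            h | ⟨j₄, hj₄, h⟩ | ⟨i', hi', h⟩
          · exact ⟨a, le_rfl, h⟩
          · exact absurd (base_row_unique h haj') (hj₄.trans_le hb).ne
          · exact ⟨i', le_of_lt hi', h⟩
        have hd : z' *ᵥ Pi.single b 1 - z *ᵥ Pi.single b 1 = 0 := by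
          ext r
          rw [Matrix.mulVec_single_one, Matrix.mulVec_single_one]
          simp only [Matrix.col_apply, Pi.sub_apply, Pi.zero_apply]
          rw [sub_eq_zero]
          by_cases hr : l < (c.index r : ℕ)
          · exact (hrows r b hbk hr).symm
          · have hT : (r, b) ∉ broadBase c := by
              intro hT
              have h1 : (c.index i₅ : ℕ) ≤ c.index r :=
                index_le_of_mem_base_of_mem_broadBase hT hS
              have h2 : (c.index a : ℕ) ≤ c.index i₅ := index_mono hi₅
              omega
            rw [hz r b hT, hz' r b hT]
        rw [hQ, Submodule.mem_comap, Matrix.mulVecLin_apply, hcol b hbk, hd, zero_add]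
        exact hW _ (mulVec_mem_blockSpan hN (single_mem_blockSpan (by omega)))
    have hzv : z *ᵥ v ∈ Q := by
      have : z *ᵥ v = ∑ b, v b • (z *ᵥ Pi.single b 1) := by
        conv_lhs => rw [eq_sum_smul_single v]
        rw [Matrix.mulVec_sum]
        exact Finset.sum_congr rfl fun b _ => Matrix.mulVec_smul _ _ _
      rw [this]
      refine Submodule.sum_mem _ fun b _ => ?_
      by_cases hb : b ≤ j'
      · exact Q.smul_mem _ (hbcol b hb)
      · rw [hv b (not_le.1 hb), zero_smul]
        exact Q.zero_mem
    -- The vector `z *ᵥ v` is a nonzero multiple of the basis vector at `a` plus earlier basis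
    -- vectors, which are in `Q` by induction.
    rw [eq_sum_smul_single (z *ᵥ v), ← Finset.add_sum_erase _ _ (Finset.mem_univ a)] at hzv
    rw [Submodule.add_mem_iff_left] at hzv
    · exact (Q.smul_mem_iff hlead.1).1 hzv
    · refine Submodule.sum_mem _ fun b hb => ?_
      rcases lt_or_gt_of_ne (Finset.ne_of_mem_erase hb) with hlt | hgt
      · have hlt' : (b : ℕ) < a := hlt
        have h2 : (c.index b : ℕ) ≤ c.index a := index_mono hlt.le
        exact Q.smul_mem _ (ih b (by omega) (by omega))
      · rw [hlead.2 b hgt, zero_smul]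
        exact Q.zero_mem

theorem section_eq_of_conj {z z' N : Matrix (Fin n) (Fin n) K}
    (hp : HasBasePivots c z) (hz : ∀ i j, (i, j) ∉ broadBase c → z i j = 0)
    (hz' : ∀ i j, (i, j) ∉ broadBase c → z' i j = 0) (hN : N ∈ nilradical K c)
    (h : (1 + N) * z = z' * (1 + N)) : z = z' := by
  have hcols : ∀ k : ℕ, ∀ i j, (c.index j : ℕ) < k → z i j = z' i j := by
    intro k
    induction k with
    | zero => intro i j hj; omega
    | succ k ih =>
      have happ : ∀ v, z *ᵥ v + N *ᵥ (z *ᵥ v) = z' *ᵥ v + z' *ᵥ (N *ᵥ v) := by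
        intro v
        have := congrArg (· *ᵥ v) h
        simpa [← Matrix.mulVec_mulVec, Matrix.add_mulVec, Matrix.mulVec_add] using this
      have heq : ∀ v ∈ blockSpan c K k, z' *ᵥ v = z *ᵥ v := by
        intro v hv
        ext i
        rw [Matrix.mulVec, Matrix.mulVec, dotProduct, dotProduct]
        refine Finset.sum_congr rfl fun b _ => ?_
        by_cases hb : (c.index b : ℕ) < k
        · rw [ih i b hb]
        · rw [hv b (not_lt.1 hb), mul_zero, mul_zero]
      have hcomm : ∀ v ∈ blockSpan c K k, N *ᵥ (z *ᵥ v) = z *ᵥ (N *ᵥ v) := by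
        intro v hv
        have := happ v
        rwa [heq v hv, heq _ (mulVec_mem_blockSpan_self hN hv), add_right_inj] at this
      have hNcol : ∀ j, (c.index j : ℕ) = k → N *ᵥ Pi.single j 1 ∈ blockSpan c K k :=
        fun j hj => mulVec_mem_blockSpan hN (single_mem_blockSpan (by omega))
      have hcol : ∀ j, (c.index j : ℕ) = k → N *ᵥ (z *ᵥ Pi.single j 1) =
          z' *ᵥ Pi.single j 1 - z *ᵥ Pi.single j 1 + z *ᵥ (N *ᵥ Pi.single j 1) := by
        intro j hj
        have := happ (Pi.single j 1)
        rw [heq _ (hNcol j hj)] at this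
        rw [sub_add_eq_add_sub, ← this, add_sub_cancel_left]
      -- Induction on `m = k - l` climbs from the diagonal block, at and below which the section
      -- vanishes.
      have hrows : ∀ m l : ℕ, l + m = k → ∀ i j, (c.index j : ℕ) = k →
          l ≤ (c.index i : ℕ) → z i j = z' i j := by
        intro m
        induction m with
        | zero =>
          intro l hl i j hj hi
          have hT : (i, j) ∉ broadBase c := by
            intro hT
            have : (c.index i : ℕ) < c.index j := index_lt_of_mem_broadBase hT
            omega
          rw [hz i j hT, hz' i j hT]
        | succ m ihm =>
          intro l hl i j hj hi
          have hrows := ihm (l + 1) (by omega)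
          rcases hi.lt_or_eq with hi | hi
          · exact hrows i j hj hi
          by_contra hne
          have hT : (i, j) ∈ broadBase c := by
            by_contra hT
            exact hne (by rw [hz i j hT, hz' i j hT])
          have hle := blockSpan_le (c := c) (k := k) fun a ha =>
            single_mem_comap_of_section hp hz hz' hN hcomm hcol
              (fun i j hj hi => hrows i j hj hi) hi.symm hj hT (a + 1) a (Nat.lt_succ_self _) ha
          have hzj : z *ᵥ Pi.single j 1 ∈ blockSpan c K k := by
            intro a ha
            rw [Matrix.mulVec_single_one, Matrix.col_apply]
            refine hz a j fun hT => ?_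
            have : (c.index a : ℕ) < c.index j := index_lt_of_mem_broadBase hT
            omega
          have hNz := hle hzj
          rw [Submodule.mem_comap, Matrix.mulVecLin_apply, hcol j hj] at hNz
          obtain ⟨v₀, hv₀, y, ⟨w, hw, rfl⟩, e⟩ := Submodule.mem_sup.1 hNz
          rw [Matrix.mulVecLin_apply] at e
          -- From row block `l` downwards, the difference of the two columns is `z *ᵥ u` with `u` in
          -- the first `k` blocks, so its leading row has a base position in an earlier column
          -- block.
          set u := w - N *ᵥ Pi.single j 1 with hu
          have huk : u ∈ blockSpan c K k := sub_mem hw (hNcol j hj)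
          have hzu : ∀ a, l ≤ (c.index a : ℕ) → (z *ᵥ u) a = z' a j - z a j := by
            intro a ha
            have e' := congrFun e a
            rw [hu, Matrix.mulVec_sub, Pi.sub_apply]
            rw [Pi.add_apply, Pi.add_apply, hv₀ a ha, Matrix.mulVec_single_one,
              Matrix.mulVec_single_one, Pi.sub_apply, Matrix.col_apply, Matrix.col_apply] at e'
            linear_combination e'
          obtain ⟨i₁, hi₁, hlead⟩ := exists_leadsAt (v := z *ᵥ u) (i := i)
            (by rw [hzu i hi.le]; exact sub_ne_zero.2 (Ne.symm hne))
          have hi₁l : l ≤ (c.index i₁ : ℕ) :=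
            hi.le.trans (show (c.index i : ℕ) ≤ c.index i₁ from index_mono hi₁)
          obtain ⟨j₁, hj₁, hS⟩ := hp.exists_base_of_mem_blockSpan huk hlead
          have hT₁ : (i₁, j) ∈ broadBase c := by
            by_contra hT₁
            refine hlead.1 ?_
            rw [hzu i₁ hi₁l, hz i₁ j hT₁, hz' i₁ j hT₁, sub_zero]
          have : (c.index j : ℕ) ≤ c.index j₁ := index_le_of_mem_broadBase_of_mem_base hT₁ hS
          omega
      intro i j hj
      rcases (Nat.lt_succ_iff.1 hj).lt_or_eq with hj | hj
      · exact ih i j hj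
      · exact hrows k 0 (zero_add k) i j hj (Nat.zero_le _)
  ext i j
  exact hcols _ i j (Nat.lt_succ_self _)

end Uniqueness

/-! ### Invariance of the open conditions under the unipotent radical. -/

section Conjugation

variable {n : ℕ} {c : Composition n} {K : Type*} [Field K]

theorem exists_mem_unipotentRadical {N : Matrix (Fin n) (Fin n) K} (hN : N ∈ nilradical K c) :
    ∃ g ∈ unipotentRadical K c, (g : Matrix (Fin n) (Fin n) K) = 1 + N := by
  have htri : (1 + N).BlockTriangular id := by
    intro i j hij
    have hij' : j < i := hij
    rw [Matrix.add_apply, Matrix.one_apply_ne hij'.ne', zero_add]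
    exact hN i j fun h => lt_asymm hij' (lt_of_index_lt h)
  have hdet : (1 + N).det = 1 := by
    rw [Matrix.det_of_isUpperTriangular htri]
    refine Finset.prod_eq_one fun i _ => ?_
    rw [Matrix.add_apply, Matrix.one_apply_eq, hN i i fun h => lt_irrefl (c.index i) h, add_zero]
  have hu : IsUnit (1 + N) := (Matrix.isUnit_iff_isUnit_det _).2 (by rw [hdet]; exact isUnit_one)
  refine ⟨hu.unit, ?_, hu.unit_spec⟩
  change (hu.unit : Matrix (Fin n) (Fin n) K) - 1 ∈ nilradical K c
  rw [hu.unit_spec, add_sub_cancel_left]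
  exact hN

theorem blockTriangular_of_mem_unipotentRadical {g : GL (Fin n) K}
    (hg : g ∈ unipotentRadical K c) :
    (g : Matrix (Fin n) (Fin n) K).BlockTriangular c.index :=
  blockTriangular_of_sub_one_mem hg

/-- The adjoint action `Ad_g x = g x g⁻¹`. -/
def adjointAction (g : GL (Fin n) K) (x : Matrix (Fin n) (Fin n) K) : Matrix (Fin n) (Fin n) K :=
  (g : Matrix (Fin n) (Fin n) K) * x * ((g⁻¹ : GL (Fin n) K) : Matrix (Fin n) (Fin n) K)

theorem adjointAction_mul_eq (g : GL (Fin n) K) (x : Matrix (Fin n) (Fin n) K) :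
    adjointAction g x * (g : Matrix (Fin n) (Fin n) K) =
      (g : Matrix (Fin n) (Fin n) K) * x := by
  unfold adjointAction
  rw [mul_assoc, Units.inv_mul, mul_one]

theorem adjointAction_mul (g h : GL (Fin n) K) (x : Matrix (Fin n) (Fin n) K) :
    adjointAction (g * h) x = adjointAction g (adjointAction h x) := by
  unfold adjointAction
  rw [mul_inv_rev, Units.val_mul, Units.val_mul]
  simp only [mul_assoc]

theorem adjointAction_inv_adjointAction (g : GL (Fin n) K) (x : Matrix (Fin n) (Fin n) K) :
    adjointAction g⁻¹ (adjointAction g x) = x := by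
  rw [← adjointAction_mul, inv_mul_cancel]
  simp [adjointAction]

theorem adjointAction_mem_nilradical {g : GL (Fin n) K} (hg : g ∈ unipotentRadical K c)
    {x : Matrix (Fin n) (Fin n) K} (hx : x ∈ nilradical K c) :
    adjointAction g x ∈ nilradical K c :=
  mul_mem_nilradical_right (blockTriangular_of_mem_unipotentRadical (inv_mem hg))
    (mul_mem_nilradical (blockTriangular_of_mem_unipotentRadical hg) hx)

theorem IsRichardson.adjointAction {g : GL (Fin n) K} (hg : g ∈ unipotentRadical K c)
    {x : Matrix (Fin n) (Fin n) K} (hx : IsRichardson c x) :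
    IsRichardson c (adjointAction g x) := by
  intro N hN
  obtain ⟨W, hW, e⟩ := hx _ (adjointAction_mem_nilradical (inv_mem hg) hN)
  refine ⟨UnitriangularInvariants.adjointAction g W,
    ((blockTriangular_of_mem_unipotentRadical hg).mul hW).mul
      (blockTriangular_of_mem_unipotentRadical (inv_mem hg)), ?_⟩
  have h1 : UnitriangularInvariants.adjointAction g
      (UnitriangularInvariants.adjointAction g⁻¹ N) = N := by
    simpa using adjointAction_inv_adjointAction g⁻¹ N
  rw [← h1, ← e]
  unfold UnitriangularInvariants.adjointAction
  rw [mul_sub, sub_mul]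
  congr 1
  · simp only [mul_assoc, Units.inv_mul_cancel_left]
  · simp only [mul_assoc, Units.inv_mul_cancel_left]

/-- The matrix `p - 1` moves each basis vector into strictly earlier blocks, so leading coordinates
survive; this makes the pivots invariant under `U`. -/
theorem mulVec_apply_eq_of_unipotent {p : Matrix (Fin n) (Fin n) K} (hp : p - 1 ∈ nilradical K c)
    {v : Fin n → K} {q : Fin n} (hv : ∀ a, q < a → v a = 0) :
    ∀ a, q ≤ a → (p *ᵥ v) a = v a := by
  intro a ha
  have h0 : ((p - 1) *ᵥ v) a = 0 := by
    rw [Matrix.mulVec, dotProduct]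
    refine Finset.sum_eq_zero fun b _ => ?_
    by_cases hab : (a, b) ∈ nilRoots c
    · rw [hv b (ha.trans_lt (lt_of_index_lt hab)), mul_zero]
    · rw [hp a b hab, zero_mul]
  rw [Matrix.sub_mulVec, Matrix.one_mulVec, Pi.sub_apply, sub_eq_zero] at h0
  exact h0

theorem exists_leadsAt_adjointAction {g : GL (Fin n) K} (hg : g ∈ unipotentRadical K c)
    {x : Matrix (Fin n) (Fin n) K} {i q : Fin n}
    (h : ∃ v : Fin n → K, (∀ a, q < a → v a = 0) ∧ LeadsAt (x *ᵥ v) i) :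
    ∃ v : Fin n → K, (∀ a, q < a → v a = 0) ∧ LeadsAt (adjointAction g x *ᵥ v) i := by
  obtain ⟨v, hv, hl⟩ := h
  refine ⟨(g : Matrix (Fin n) (Fin n) K) *ᵥ v, fun a ha => ?_, ?_⟩
  · rw [mulVec_apply_eq_of_unipotent hg hv a ha.le, hv a ha]
  · rw [Matrix.mulVec_mulVec, adjointAction_mul_eq, ← Matrix.mulVec_mulVec]
    refine ⟨?_, fun a ha => ?_⟩
    · rw [mulVec_apply_eq_of_unipotent hg hl.2 i le_rfl]; exact hl.1
    · rw [mulVec_apply_eq_of_unipotent hg hl.2 a ha.le, hl.2 a ha]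

theorem HasBasePivots.adjointAction {g : GL (Fin n) K} (hg : g ∈ unipotentRadical K c)
    {x : Matrix (Fin n) (Fin n) K} (hx : HasBasePivots c x) :
    HasBasePivots c (adjointAction g x) := by
  intro i q
  rw [← hx i q]
  refine ⟨fun h => ?_, exists_leadsAt_adjointAction hg⟩
  have := exists_leadsAt_adjointAction (inv_mem hg) h
  rwa [adjointAction_inv_adjointAction] at this

end Conjugation

/-! ### Existence: moving a generic element into the section. -/

section Existence

variable {n : ℕ} {c : Composition n} {K : Type*} [Field K]

theorem exists_functional_of_linearIndependent {ι M : Type*} [AddCommGroup M] [Module K M]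
    {f : ι → M} (hf : LinearIndependent K f) (b : ι → K) :
    ∃ φ : M →ₗ[K] K, ∀ i, φ (f i) = b i := by
  obtain ⟨φ, hφ⟩ := LinearMap.exists_extend ((Finsupp.linearCombination K b) ∘ₗ hf.repr)
  refine ⟨φ, fun i => ?_⟩
  have := LinearMap.congr_fun hφ ⟨f i, Submodule.subset_span ⟨i, rfl⟩⟩
  rw [LinearMap.comp_apply, Submodule.subtype_apply] at this
  rw [this, LinearMap.comp_apply, hf.repr_eq_single i _ rfl]
  simp

/-- Modulo the image of the first blocks, each vector is supported off the pivots. -/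
theorem exists_reduction {x : Matrix (Fin n) (Fin n) K} (hp : HasBasePivots c x) (k m : ℕ) :
    ∀ v : Fin n → K, (∀ a : Fin n, m ≤ a → v a = 0) → ∃ u ∈ blockSpan c K k,
      ∀ i, (∃ j, (i, j) ∈ base c ∧ (c.index j : ℕ) < k) → (v + x *ᵥ u) i = 0 := by
  induction m with
  | zero =>
    intro v hv
    refine ⟨0, zero_mem _, fun i _ => ?_⟩
    rw [show v = 0 from funext fun a => hv a (Nat.zero_le _)]
    simp
  | succ m ih =>
    intro v hv
    by_cases hm : m < n
    swap
    · exact ih v fun a ha => absurd a.2 (by omega)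
    set a₀ : Fin n := ⟨m, hm⟩ with ha₀
    by_cases hpiv : ∃ j, (a₀, j) ∈ base c ∧ (c.index j : ℕ) < k
    · obtain ⟨j, hS, hj⟩ := hpiv
      obtain ⟨w, hw, hl⟩ := (hp a₀ j).2 ⟨j, le_rfl, hS⟩
      have hwk : w ∈ blockSpan c K k := fun a ha => hw a (by
        by_contra hle
        have : (c.index a : ℕ) ≤ c.index j := index_mono (not_lt.1 hle)
        omega)
      obtain ⟨u, hu, h⟩ := ih (v - (v a₀ / (x *ᵥ w) a₀) • (x *ᵥ w)) (fun a ha => by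
        rw [Pi.sub_apply, Pi.smul_apply, smul_eq_mul]
        rcases ha.eq_or_lt with e | e
        · rw [show a = a₀ from Fin.ext e.symm, div_mul_cancel₀ _ hl.1, sub_self]
        · rw [hv a e, hl.2 a (Fin.lt_def.2 e), mul_zero, sub_zero])
      refine ⟨u - (v a₀ / (x *ᵥ w) a₀) • w, sub_mem hu (Submodule.smul_mem _ _ hwk),
        fun i hi => ?_⟩
      rw [← h i hi, Matrix.mulVec_sub, Matrix.mulVec_smul]
      refine congrFun ?_ i
      abel
    -- Nothing is required of row `a₀`, so its coordinate is dropped.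
    · obtain ⟨u, hu, h⟩ := ih (v - v a₀ • Pi.single a₀ 1) (fun a ha => by
        rcases ha.eq_or_lt with e | e
        · rw [show a = a₀ from Fin.ext e.symm]; simp
        · have hne : a ≠ a₀ := fun he => e.ne' (congrArg Fin.val he)
          simp [hv a e, hne])
      refine ⟨u, hu, fun i hi => ?_⟩
      have hne : i ≠ a₀ := by rintro rfl; exact hpiv hi
      rw [← h i hi]
      simp [hne]

/-- A relation gives a vector `r` with last nonzero coordinate at a column `j₀` and with `x *ᵥ r` in
the first `l` blocks. It could be used to eliminate column `j₀` without affecting the rows from the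
pivot of `j₀` downwards, so that pivot would already occur among earlier columns. -/
theorem linearIndependent_columns {x : Matrix (Fin n) (Fin n) K} (hp : HasBasePivots c x)
    (k l : ℕ) : LinearIndependent K
      (fun j : {j : Fin n // (c.index j : ℕ) = k ∧ ∃ i, (i, j) ∈ base c ∧ l ≤ (c.index i : ℕ)} =>
        (blockSpan c K l ⊔ (blockSpan c K k).map x.mulVecLin).mkQ (x *ᵥ Pi.single j.1 1)) := by
  classical
  rw [Fintype.linearIndependent_iff]
  intro t ht
  by_contra! hne
  obtain ⟨j₁, hj₁⟩ := hne
  obtain ⟨j₀, hj₀, hmax⟩ := Finset.exists_max_image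
    (Finset.univ.filter fun j => t j ≠ 0) (fun j => j.1) ⟨j₁, by simp [hj₁]⟩
  simp only [Finset.mem_filter, Finset.mem_univ, true_and] at hj₀ hmax
  set s : Fin n → K := ∑ j, t j • Pi.single j.1 1 with hs
  have hsval : ∀ a, (∀ j, j.1 = a → t j = 0) → s a = 0 := by
    intro a ha
    rw [hs, Finset.sum_apply]
    refine Finset.sum_eq_zero fun j _ => ?_
    by_cases e : j.1 = a
    · simp [ha j e]
    · simp [Ne.symm e]
  have hs₀ : s j₀.1 = t j₀ := by
    rw [hs, Finset.sum_apply, Finset.sum_eq_single j₀]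
    · simp
    · intro j _ hj
      have : j₀.1 ≠ j.1 := fun e => hj (Subtype.ext e.symm)
      simp [this]
    · simp
  simp only [← map_smul, ← map_sum] at ht
  rw [Submodule.mkQ_apply, Submodule.Quotient.mk_eq_zero] at ht
  have hxs : x *ᵥ s = ∑ j, t j • (x *ᵥ Pi.single j.1 1) := by
    rw [hs, Matrix.mulVec_sum]
    exact Finset.sum_congr rfl fun j _ => Matrix.mulVec_smul _ _ _
  rw [← hxs] at ht
  obtain ⟨v₀, hv₀, y, ⟨w, hw, rfl⟩, e⟩ := Submodule.mem_sup.1 ht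
  rw [Matrix.mulVecLin_apply] at e
  set r := s - w with hr
  have hxr : x *ᵥ r = v₀ := by rw [hr, Matrix.mulVec_sub, ← e, add_sub_cancel_right]
  have hwge : ∀ a, j₀.1 ≤ a → w a = 0 := fun a ha => hw a (by
    rw [← j₀.2.1]; exact index_mono ha)
  have hr₀ : r j₀.1 = t j₀ := by rw [hr, Pi.sub_apply, hs₀, hwge _ le_rfl, sub_zero]
  have hrgt : ∀ a, j₀.1 < a → r a = 0 := by
    intro a ha
    rw [hr, Pi.sub_apply, hwge a ha.le, sub_zero]
    refine hsval a fun j hj => ?_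
    by_contra hne
    exact absurd (hmax j hne) (not_le.2 (hj ▸ ha))
  obtain ⟨i₀, hS, hi₀⟩ := j₀.2.2
  obtain ⟨v, hv, hl⟩ := (hp i₀ j₀.1).2 ⟨j₀.1, le_rfl, hS⟩
  set v' := v - (v j₀.1 / t j₀) • r with hv'
  have hxv' : ∀ a, i₀ ≤ a → (x *ᵥ v') a = (x *ᵥ v) a := by
    intro a ha
    have : v₀ a = 0 := hv₀ a (hi₀.trans (index_mono ha))
    rw [hv', Matrix.mulVec_sub, Matrix.mulVec_smul, hxr, Pi.sub_apply, Pi.smul_apply, this,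
      smul_zero, sub_zero]
  have hl' : LeadsAt (x *ᵥ v') i₀ :=
    ⟨by rw [hxv' _ le_rfl]; exact hl.1, fun a ha => by rw [hxv' a ha.le, hl.2 a ha]⟩
  obtain ⟨j, q, hjq, hq, hij⟩ := hp.exists_base hl'
  rw [base_row_unique hij hS] at hjq
  rcases hjq.eq_or_lt with rfl | hlt
  · apply hq
    rw [hv', Pi.sub_apply, Pi.smul_apply, hr₀, smul_eq_mul, div_mul_cancel₀ _ hj₀, sub_self]
  · apply hq
    rw [hv', Pi.sub_apply, Pi.smul_apply, hv q hlt, hrgt q hlt, smul_zero, sub_zero]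

/-- The functional is row `i` of the correction `N`: its vanishing on the blocks up to that of `i`
puts `N` in the nilradical, and its vanishing on `x V_k` gives `N x V_k = 0`. By
`exists_base_below`, the columns to be corrected in this row are among those of
`linearIndependent_columns`, unless `y` already vanishes in the row. -/
theorem exists_row_functional {x : Matrix (Fin n) (Fin n) K}
    (hp : HasBasePivots c x) (k : ℕ) (y : Fin n → Fin n → K)
    (hy : ∀ i j, (∃ j', (i, j') ∈ base c ∧ (c.index j' : ℕ) < k) → y i j = 0)
    (hyk : ∀ i j, k ≤ (c.index i : ℕ) → y i j = 0) (i : Fin n) :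
    ∃ φ : (Fin n → K) →ₗ[K] K, (∀ v ∈ blockSpan c K (c.index i + 1), φ v = 0) ∧
      (∀ v ∈ blockSpan c K k, φ (x *ᵥ v) = 0) ∧
      ∀ j, (c.index j : ℕ) = k → (i, j) ∉ broadBase c → φ (x *ᵥ Pi.single j 1) = -y i j := by
  by_cases h : (∃ j', (i, j') ∈ base c ∧ (c.index j' : ℕ) < k) ∨ k ≤ (c.index i : ℕ)
  · refine ⟨0, fun _ _ => rfl, fun _ _ => rfl, fun j _ _ => ?_⟩
    rw [h.elim (hy i j) (hyk i j)]
    simp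
  · push Not at h
    obtain ⟨φ, hφ⟩ := exists_functional_of_linearIndependent
      (linearIndependent_columns hp k (c.index i + 1)) fun j => -y i j.1
    refine ⟨φ ∘ₗ Submodule.mkQ _, fun v hv => ?_, fun v hv => ?_, fun j hj hT => ?_⟩
    · rw [LinearMap.comp_apply, Submodule.mkQ_apply,
        (Submodule.Quotient.mk_eq_zero _).2 (Submodule.mem_sup_left hv), map_zero]
    · rw [LinearMap.comp_apply, Submodule.mkQ_apply, ← Matrix.mulVecLin_apply,
        (Submodule.Quotient.mk_eq_zero _).2
          (Submodule.mem_sup_right (Submodule.mem_map_of_mem (f := x.mulVecLin) hv)), map_zero]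
    · obtain ⟨i', hS, hi'⟩ := exists_base_below (c := c) (i := i) (j := j)
        (Fin.lt_def.2 (hj ▸ h.2)) (fun j' hj' => Fin.le_def.2 (hj ▸ h.1 j' hj')) hT
      exact hφ ⟨j, hj, i', hS, hi'⟩

/-- The columns of one further block can be brought into the section. -/
theorem exists_column_correction {x : Matrix (Fin n) (Fin n) K} (hx : x ∈ nilradical K c)
    (hp : HasBasePivots c x) (k : ℕ) :
    ∃ N ∈ nilradical K c, (∀ v ∈ blockSpan c K k, N *ᵥ (x *ᵥ v) = 0) ∧
      ∃ u : Fin n → Fin n → K, (∀ j, u j ∈ blockSpan c K k) ∧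
        ∀ i j, (c.index j : ℕ) = k → (i, j) ∉ broadBase c →
          (x *ᵥ Pi.single j 1 + N *ᵥ (x *ᵥ Pi.single j 1) + x *ᵥ u j) i = 0 := by
  choose u hu hred using fun j => exists_reduction hp k n (x *ᵥ Pi.single j 1)
    fun a ha => absurd a.2 (not_lt.2 ha)
  classical
  -- The value 0 outside column block `k` makes the vanishing conditions of `exists_row_functional`
  -- hold for every `j`.
  let y : Fin n → Fin n → K := fun i j =>
    if (c.index j : ℕ) = k then (x *ᵥ Pi.single j 1 + x *ᵥ u j) i else 0
  have hy : ∀ i j, (c.index j : ℕ) = k → y i j = (x *ᵥ Pi.single j 1 + x *ᵥ u j) i :=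
    fun i j hj => if_pos hj
  choose φ hφ₁ hφ₂ hφ₃ using exists_row_functional hp k y
    (fun i j hi => by
      by_cases hj : (c.index j : ℕ) = k
      · rw [hy i j hj, hred j i hi]
      · exact if_neg hj)
    (fun i j hi => by
      by_cases hj : (c.index j : ℕ) = k
      · rw [hy i j hj]
        have hsum : x *ᵥ Pi.single j 1 + x *ᵥ u j ∈ blockSpan c K k :=
          add_mem (mulVec_mem_blockSpan hx (single_mem_blockSpan (by omega)))
            (mulVec_mem_blockSpan_self hx (hu j))
        exact hsum i hi
      · exact if_neg hj)
  set N : Matrix (Fin n) (Fin n) K := Matrix.of fun i a => φ i (Pi.single a 1) with hN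
  have hNv : ∀ v i, (N *ᵥ v) i = φ i v := by
    intro v i
    conv_rhs => rw [eq_sum_smul_single v, map_sum]
    rw [Matrix.mulVec, dotProduct]
    refine Finset.sum_congr rfl fun a _ => ?_
    rw [map_smul, smul_eq_mul, mul_comm]
    rfl
  refine ⟨N, fun i a hia => ?_, fun v hv => ?_, u, hu, fun i j hj hT => ?_⟩
  · have hle : (c.index a : ℕ) ≤ c.index i := not_lt.1 hia
    exact hφ₁ i _ (single_mem_blockSpan (Nat.lt_succ_of_le hle))
  · ext i
    rw [hNv, hφ₂ i v hv]
    rfl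
  · rw [add_right_comm, Pi.add_apply, ← hy i j hj, hNv, hφ₃ i j hj hT, add_neg_cancel]

/-- Since `N = [W, x]` kills `x V_k`, conjugation by `1 + W x` fixes `x` on `V_k` and changes a
column `x e_j` of block `k` to `x e_j + N x e_j`. Subtracting `u j` from column `j` of `W x` adds
the missing term `x u_j`. The factor `x` is what puts the conjugating matrix in `U`, as `W` itself
is only block triangular. -/
theorem exists_conj_column_block {x : Matrix (Fin n) (Fin n) K} (hx : x ∈ nilradical K c)
    (hp : HasBasePivots c x) (hR : IsRichardson c x) {k : ℕ}
    (hcols : ∀ i j, (c.index j : ℕ) < k → (i, j) ∉ broadBase c → x i j = 0) :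
    ∃ g ∈ unipotentRadical K c, ∀ i j, (c.index j : ℕ) < k + 1 → (i, j) ∉ broadBase c →
      adjointAction g x i j = 0 := by
  classical
  obtain ⟨N, hN, hNx, u, hu, hcol⟩ := exists_column_correction hx hp k
  obtain ⟨W, hW, hWN⟩ := hR N hN
  set G : Matrix (Fin n) (Fin n) K := Matrix.of fun i j =>
    if (c.index j : ℕ) < k then (W * x) i j
    else if (c.index j : ℕ) = k then (W * x) i j - u j i else 0 with hG
  have hWx : W * x ∈ nilradical K c := mul_mem_nilradical hW hx
  have hGmem : G ∈ nilradical K c := by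
    intro i j hij
    simp only [hG, Matrix.of_apply]
    split_ifs with h1 h2
    · exact hWx i j hij
    · have hle : (c.index j : ℕ) ≤ c.index i := not_lt.1 hij
      rw [hWx i j hij, hu j i (by omega), sub_zero]
    · rfl
  obtain ⟨g, hg, hgG⟩ := exists_mem_unipotentRadical hGmem
  have hGV : ∀ v ∈ blockSpan c K k, G *ᵥ v = W *ᵥ (x *ᵥ v) := by
    intro v hv
    rw [Matrix.mulVec_mulVec]
    ext i
    rw [Matrix.mulVec, Matrix.mulVec, dotProduct, dotProduct]
    refine Finset.sum_congr rfl fun b _ => ?_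
    by_cases hb : (c.index b : ℕ) < k
    · simp [hG, hb]
    · rw [hv b (not_lt.1 hb), mul_zero, mul_zero]
  have hGcol : ∀ j, (c.index j : ℕ) = k →
      G *ᵥ Pi.single j 1 = W *ᵥ (x *ᵥ Pi.single j 1) - u j := by
    intro j hj
    rw [Matrix.mulVec_mulVec]
    ext i
    rw [Pi.sub_apply, Matrix.mulVec_single_one, Matrix.mulVec_single_one, Matrix.col_apply,
      Matrix.col_apply]
    simp [hG, hj]
  have hNv : ∀ v, N *ᵥ v = W *ᵥ (x *ᵥ v) - x *ᵥ (W *ᵥ v) := by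
    intro v
    rw [← hWN, Matrix.sub_mulVec, Matrix.mulVec_mulVec, Matrix.mulVec_mulVec]
  have hg' : ∀ v, adjointAction g x *ᵥ (v + G *ᵥ v) = x *ᵥ v + G *ᵥ (x *ᵥ v) := by
    intro v
    have h1 : v + G *ᵥ v = (g : Matrix (Fin n) (Fin n) K) *ᵥ v := by
      rw [hgG, Matrix.add_mulVec, Matrix.one_mulVec]
    rw [h1, Matrix.mulVec_mulVec, adjointAction_mul_eq, ← Matrix.mulVec_mulVec, hgG,
      Matrix.add_mulVec, Matrix.one_mulVec]
  -- The matrix `g` maps `V_k` onto itself, so `hg'` determines the conjugate on all of `V_k`.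
  have hginv : ∀ v ∈ blockSpan c K k, ∃ v' ∈ blockSpan c K k, v = v' + G *ᵥ v' := by
    intro v hv
    have hgi : ((g⁻¹ : GL (Fin n) K) : Matrix (Fin n) (Fin n) K) - 1 ∈ nilradical K c :=
      inv_mem hg
    refine ⟨((g⁻¹ : GL (Fin n) K) : Matrix (Fin n) (Fin n) K) *ᵥ v, ?_, ?_⟩
    · have := add_mem (mulVec_mem_blockSpan_self hgi hv) hv
      rwa [Matrix.sub_mulVec, Matrix.one_mulVec, sub_add_cancel] at this
    · have : ∀ w, w + G *ᵥ w = (g : Matrix (Fin n) (Fin n) K) *ᵥ w := fun w => by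
        rw [hgG, Matrix.add_mulVec, Matrix.one_mulVec]
      rw [this, Matrix.mulVec_mulVec, Units.mul_inv, Matrix.one_mulVec]
  have hsame : ∀ v ∈ blockSpan c K k, adjointAction g x *ᵥ v = x *ᵥ v := by
    intro v hv
    obtain ⟨v', hv', rfl⟩ := hginv v hv
    have h0 := hNx v' hv'
    rw [hNv, sub_eq_zero] at h0
    rw [hg', Matrix.mulVec_add, hGV v' hv', hGV _ (mulVec_mem_blockSpan_self hx hv'), h0]
  refine ⟨g, hg, fun i j hj hT => ?_⟩
  have hcolapp : ∀ z : Matrix (Fin n) (Fin n) K, z i j = (z *ᵥ Pi.single j 1) i := fun z => by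
    rw [Matrix.mulVec_single_one, Matrix.col_apply]
  rcases (Nat.lt_succ_iff.1 hj).lt_or_eq with hj | hj
  · rw [hcolapp (adjointAction g x), hsame _ (single_mem_blockSpan hj), ← hcolapp x, hcols i j hj hT]
  · have hGk : G *ᵥ Pi.single j 1 ∈ blockSpan c K k :=
      mulVec_mem_blockSpan hGmem (single_mem_blockSpan (by omega))
    have hxk : x *ᵥ Pi.single j 1 ∈ blockSpan c K k :=
      mulVec_mem_blockSpan hx (single_mem_blockSpan (by omega))
    have h1 := hg' (Pi.single j 1)
    rw [Matrix.mulVec_add, hsame _ hGk, hGV _ hxk, hGcol j hj, Matrix.mulVec_sub] at h1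
    rw [hcolapp (adjointAction g x), ← hcol i j hj hT, hNv]
    refine congrFun ?_ i
    rw [← sub_eq_zero] at h1 ⊢
    rw [← h1]
    abel

theorem exists_conj_mem_section {x : Matrix (Fin n) (Fin n) K} (hx : x ∈ nilradical K c)
    (hp : HasBasePivots c x) (hR : IsRichardson c x) :
    ∃ g ∈ unipotentRadical K c, ∀ i j, (i, j) ∉ broadBase c → adjointAction g x i j = 0 := by
  have key : ∀ k : ℕ, ∃ g ∈ unipotentRadical K c, ∀ i j, (c.index j : ℕ) < k →
      (i, j) ∉ broadBase c → adjointAction g x i j = 0 := by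
    intro k
    induction k with
    | zero => exact ⟨1, one_mem _, fun i j hj => by omega⟩
    | succ k ih =>
      obtain ⟨h, hh, hcols⟩ := ih
      obtain ⟨g, hg, hcols'⟩ := exists_conj_column_block (adjointAction_mem_nilradical hh hx)
        (hp.adjointAction hh) (hR.adjointAction hh) hcols
      refine ⟨g * h, mul_mem hg hh, fun i j hj hT => ?_⟩
      rw [adjointAction_mul]
      exact hcols' i j hj hT
  obtain ⟨g, hg, h⟩ := key c.length
  exact ⟨g, hg, fun i j => h i j (c.index j).2⟩

end Existence

end UnitriangularInvariants

theorem proposition4p1 (K : Type*) [Field K] [IsAlgClosed K] [CharZero K]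
    (n : ℕ) (c : Composition n) :
    ∃ V : Set (UnitriangularInvariants.nilradical K c),
      V.Nonempty ∧ UnitriangularInvariants.IsZariskiOpen V ∧
      ∀ x ∈ V, ∃! z : Matrix (Fin n) (Fin n) K,
        z ∈ UnitriangularInvariants.unipotentOrbit c (x : Matrix (Fin n) (Fin n) K) ∧
        z ∈ UnitriangularInvariants.sectionSpace K c := by
  open UnitriangularInvariants in
  obtain ⟨V, hne, hopen, hV⟩ := exists_isZariskiOpen_generic c K
  refine ⟨V, hne, hopen, fun x hx => ?_⟩
  obtain ⟨hp, hR⟩ := hV x hx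
  obtain ⟨g, hg, hz⟩ := exists_conj_mem_section x.2 hp hR
  refine ⟨adjointAction g x.1, ⟨⟨g, hg, rfl⟩, mem_sectionSpace_iff.2 hz⟩, ?_⟩
  rintro _ ⟨⟨g', hg', rfl⟩, hz'⟩
  change adjointAction g' x.1 ∈ _ at hz'
  change adjointAction g' x.1 = adjointAction g x.1
  -- This element of `U` carries the first section point to the second.
  have hmem : g' * g⁻¹ ∈ unipotentRadical K c := mul_mem hg' (inv_mem hg)
  have hconj : adjointAction (g' * g⁻¹) (adjointAction g x.1) = adjointAction g' x.1 := by
    rw [← adjointAction_mul, inv_mul_cancel_right]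
  refine (section_eq_of_conj (hp.adjointAction hg) hz (mem_sectionSpace_iff.1 hz')
    (N := ((g' * g⁻¹ : GL (Fin n) K) : Matrix (Fin n) (Fin n) K) - 1) hmem ?_).symm
  rw [add_sub_cancel, ← hconj, adjointAction_mul_eq]
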